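/- **Corollary (polytrees and oriented paths).** Let $P$ be a partial order on a set of $n\ge 1$ elements, each element $v$ carrying a weight $w(v)\in\mathbb{R}^2$. Let $\mathrm{poly}(P)\subset\mathbb{R}^2$ be the convex hull of the finite point set $\{\sum_{v\in S} w(v) : S \text{ a lower set of } P\}$. A polytree is a directed graph obtained by orienting the edges of an undirected tree; an oriented path is one obtained by orienting (arbitrarily) the edges of an undirected path. $P$ is the reachability order of a directed graph $T$ on the same elements if $u\le v$ holds exactly when there is a (possibly empty) directed walk from $u$ to $v$ in $T$. Running times are counted on a real-number machine in which arithmetic operations and comparisons on natural numbers (addition, truncated subtraction, halving) and on real numbers (addition, subtraction, multiplication, division), and creating or reading a two-field record, take one step each, and which runs one fixed program for all inputs (a finite system of recursive first-order functions). The input is the number $n$ of vertices, the list of edges of $T$ in any order and for any numbering of the vertices, and the list of weights; to construct $\mathrm{poly}(P)$ means to output the list of its vertices, each once, in counterclockwise cyclic order. 1. If $P$ is the reachability order of a polytree $T$, then, for all weights, $\mathrm{poly}(P)$ has $O\bigl(n^{1+1/\log_2(3/2)}\bigr)$ vertices, and it can be constructed in time $O\bigl(n^{1+1/\log_2(3/2)}\log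 (n+1)\bigr)$. 2. If $T$ is moreover an oriented path, then, for all weights, $\mathrm{poly}(P)$ has $O(n^2)$ vertices, and it can be constructed in time $O\bigl(n^2\log (n+1)\bigr)$. The constants in the $O$-bounds are absolute: they depend neither on $n$, nor on $T$, nor on the weights. -/

import Mathlib

namespace ParametricClosure

/-! ### Polytrees and their reachability orders -/

/-- A polytree: an orientation of an undirected tree (no loops, no pair of opposite edges, and the
underlying undirected graph is a tree). -/
structure IsPolytree {V : Type*} (D : Digraph V) : Prop where
  asymm : ∀ u v, D.Adj u v → ¬ D.Adj v u
  isTree : D.toSimpleGraphInclusive.IsTree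

/-- An oriented path: an orientation of an undirected path. The edges may be oriented in an
arbitrary way, independently of each other. -/
structure IsOrientedPath {V : Type*} [Fintype V] (D : Digraph V) : Prop where
  isPolytree : IsPolytree D
  isPath : Nonempty (D.toSimpleGraphInclusive ≃g SimpleGraph.pathGraph (Fintype.card V))

/-- The order of `V` is the reachability order of `D`. -/
def IsReachabilityOrder {V : Type*} [PartialOrder V] (D : Digraph V) : Prop :=
  ∀ u v : V, u ≤ v ↔ Relation.ReflTransGen D.Adj u v

/-! ### The polygon of a weighted partial order -/

/-- The planar point set of a family of sets: each set is sent to the sum of the weights of its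
elements. -/
noncomputable def project {V : Type*} [Fintype V] (w : V → ℝ × ℝ) (F : Set (Set V)) :
    Set (ℝ × ℝ) :=
  (fun S : Set V => ∑ v, S.indicator w v) '' F

/-- The family of lower sets of a partial order. -/
def lowerSets (V : Type*) [PartialOrder V] : Set (Set V) := {S | IsLowerSet S}

/-- The convex hull of the projected lower sets. -/
noncomputable def polygon {V : Type*} [Fintype V] [PartialOrder V] (w : V → ℝ × ℝ) :
    Set (ℝ × ℝ) :=
  convexHull ℝ (project w (lowerSets V))

/-- The vertices of a convex set in the plane. -/
def vertices (K : Set (ℝ × ℝ)) : Set (ℝ × ℝ) := K.extremePoints ℝ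

/-- Twice the signed area of the triangle `p q r`: nonnegative iff `r` is to the left of, or on,
the line directed from `p` to `q`. -/
def orient (p q r : ℝ × ℝ) : ℝ :=
  (q.1 - p.1) * (r.2 - p.2) - (q.2 - p.2) * (r.1 - p.1)

/-- `l` lists every vertex of the convex polygon `K` exactly once, in counterclockwise cyclic
order: `K` lies to the left of each directed line from an entry of the list to the cyclically next
entry. -/
structure IsVertexList (l : List (ℝ × ℝ)) (K : Set (ℝ × ℝ)) : Prop where
  nodup : l.Nodup
  mem_iff : ∀ p, p ∈ l ↔ p ∈ vertices K
  ccw : ∀ (i : ℕ) (hi : i < l.length), ∀ r ∈ K,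
    0 ≤ orient l[i] (l[(i + 1) % l.length]'(Nat.mod_lt _ (by omega))) r

/-! ### Machine model

Programs are finite systems of mutually recursive first-order functions. The data are natural
numbers, exact real numbers, and pointers to immutable two-field records (so a value is passed on,
stored or returned in constant time, without copying). Every evaluated node of an expression costs
one unit. A real RAM simulates this with a constant factor overhead; the only data shared between
different inputs is the finite program text. -/

/-- Values. -/
inductive Val where
  | nat (k : ℕ)
  | real (x : ℝ)
  | nil
  | cons (a b : Val)

/-- Unary primitive operations. -/
inductive UnOp where
  /-- first field of a record -/
  | fst
  /-- second field of a record -/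
  | snd
  /-- test whether the argument is a record (answer `1` or `0`) -/
  | isCons
  /-- halve a natural number, rounding down -/
  | half

/-- Binary primitive operations. Tests answer `1` or `0`. -/
inductive BinOp where
  | cons
  | natAdd
  | natSub
  | natEq
  | natLt
  | realAdd
  | realSub
  | realMul
  | realDiv
  | realLt

/-- Meaning of the unary operations; `none` is a run-time error. -/
def UnOp.run : UnOp → Val → Option Val
  | .fst, .cons a _ => some a
  | .snd, .cons _ b => some b
  | .isCons, .cons _ _ => some (.nat 1)
  | .isCons, _ => some (.nat 0)
  | .half, .nat k => some (.nat (k / 2))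
  | _, _ => none

open Classical in
/-- Meaning of the binary operations; `none` is a run-time error. -/
noncomputable def BinOp.run : BinOp → Val → Val → Option Val
  | .cons, a, b => some (.cons a b)
  | .natAdd, .nat j, .nat k => some (.nat (j + k))
  | .natSub, .nat j, .nat k => some (.nat (j - k))
  | .natEq, .nat j, .nat k => some (.nat (if j = k then 1 else 0))
  | .natLt, .nat j, .nat k => some (.nat (if j < k then 1 else 0))
  | .realAdd, .real x, .real y => some (.real (x + y))
  | .realSub, .real x, .real y => some (.real (x - y))
  | .realMul, .real x, .real y => some (.real (x * y))
  | .realDiv, .real x, .real y => if y = 0 then none else some (.real (x / y))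
  | .realLt, .real x, .real y => some (.nat (if x < y then 1 else 0))
  | _, _, _ => none

/-- Expressions. Local variables are numbered from the innermost binder outwards. -/
inductive Expr where
  | var (i : ℕ)
  | natConst (k : ℕ)
  | realConst (q : ℚ)
  | nil
  | un (o : UnOp) (e : Expr)
  | bin (o : BinOp) (e₁ e₂ : Expr)
  /-- `ite c e₁ e₂` is `e₁` if the natural number `c` is not `0`, and `e₂` otherwise -/
  | ite (c e₁ e₂ : Expr)
  /-- evaluate `e₁` and bind the result as variable `0` of `e₂` -/
  | letIn (e₁ e₂ : Expr)
  /-- call function number `f` of the program -/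
  | call (f : ℕ) (e : Expr)

/-- A program: the list of the bodies of its functions. Each function has one argument, variable
`0` of its body; several arguments are passed as one record. -/
abbrev Program := List Expr

/-- `Eval P env e v t`: in program `P`, with local variables `env`, the expression `e` evaluates
(call by value) to `v` in exactly `t` steps. -/
inductive Eval (P : Program) : List Val → Expr → Val → ℕ → Prop where
  | var {env i v} : env[i]? = some v → Eval P env (.var i) v 1
  | natConst {env k} : Eval P env (.natConst k) (.nat k) 1
  | realConst {env} {q : ℚ} : Eval P env (.realConst q) (.real (q : ℝ)) 1
  | nil {env} : Eval P env .nil .nil 1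
  | un {env o e v r t} : Eval P env e v t → o.run v = some r → Eval P env (.un o e) r (t + 1)
  | bin {env o e₁ e₂ v₁ v₂ r t₁ t₂} :
      Eval P env e₁ v₁ t₁ → Eval P env e₂ v₂ t₂ → o.run v₁ v₂ = some r →
      Eval P env (.bin o e₁ e₂) r (t₁ + t₂ + 1)
  | iteTrue {env c e₁ e₂ k v t₁ t₂} :
      Eval P env c (.nat (k + 1)) t₁ → Eval P env e₁ v t₂ →
      Eval P env (.ite c e₁ e₂) v (t₁ + t₂ + 1)
  | iteFalse {env c e₁ e₂ v t₁ t₂} :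
      Eval P env c (.nat 0) t₁ → Eval P env e₂ v t₂ →
      Eval P env (.ite c e₁ e₂) v (t₁ + t₂ + 1)
  | letIn {env e₁ e₂ v₁ v₂ t₁ t₂} :
      Eval P env e₁ v₁ t₁ → Eval P (v₁ :: env) e₂ v₂ t₂ →
      Eval P env (.letIn e₁ e₂) v₂ (t₁ + t₂ + 1)
  | call {env f body e v₁ v₂ t₁ t₂} :
      Eval P env e v₁ t₁ → P[f]? = some body → Eval P [v₁] body v₂ t₂ →
      Eval P env (.call f e) v₂ (t₁ + t₂ + 1)

/-- A program has at most one result and one running time on each input. -/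
theorem Eval.deterministic {P : Program} {env : List Val} {e : Expr} {v v' : Val} {t t' : ℕ}
    (h : Eval P env e v t) (h' : Eval P env e v' t') : v = v' ∧ t = t' := by
  induction h generalizing v' t' with
  | var h => cases h' with | var h₂ => simp_all
  | natConst => cases h'; simp
  | realConst => cases h'; simp
  | nil => cases h'; simp
  | un _ hr ih =>
    cases h' with | un h₂ hr₂ =>
    obtain ⟨rfl, rfl⟩ := ih h₂
    simp_all
  | bin _ _ hr ih₁ ih₂ =>
    cases h' with | bin h₁ h₂ hr₂ =>
    obtain ⟨rfl, rfl⟩ := ih₁ h₁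
    obtain ⟨rfl, rfl⟩ := ih₂ h₂
    simp_all
  | iteTrue _ _ ih₁ ih₂ =>
    cases h' with
    | iteTrue h₁ h₂ =>
      obtain ⟨_, rfl⟩ := ih₁ h₁
      obtain ⟨rfl, rfl⟩ := ih₂ h₂
      simp
    | iteFalse h₁ h₂ => simpa using (ih₁ h₁).1
  | iteFalse _ _ ih₁ ih₂ =>
    cases h' with
    | iteTrue h₁ h₂ => simpa using (ih₁ h₁).1
    | iteFalse h₁ h₂ =>
      obtain ⟨_, rfl⟩ := ih₁ h₁
      obtain ⟨rfl, rfl⟩ := ih₂ h₂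
      simp
  | letIn _ _ ih₁ ih₂ =>
    cases h' with | letIn h₁ h₂ =>
    obtain ⟨rfl, rfl⟩ := ih₁ h₁
    obtain ⟨rfl, rfl⟩ := ih₂ h₂
    simp
  | call _ hb _ ih₁ ih₂ =>
    cases h' with | call h₁ hb₂ h₂ =>
    obtain ⟨rfl, rfl⟩ := ih₁ h₁
    rw [hb] at hb₂
    cases hb₂
    obtain ⟨rfl, rfl⟩ := ih₂ h₂
    simp

/-- The program, started with function `0` on the given input, stops with the given output after
exactly `t` steps. -/
def Program.Computes (P : Program) (input output : Val) (t : ℕ) : Prop :=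
  Eval P [input] (.call 0 (.var 0)) output t

/-! ### Input and output formats -/

/-- Linked lists. -/
def encodeList : List Val → Val
  | [] => .nil
  | a :: l => .cons a (encodeList l)

/-- A point, or a two-dimensional weight, is the record of its coordinates. -/
def encodePoint (p : ℝ × ℝ) : Val := .cons (.real p.1) (.real p.2)

/-- A list of points. -/
def encodePoints (l : List (ℝ × ℝ)) : Val := encodeList (l.map encodePoint)

/-- A directed edge between numbered vertices is the record of the numbers of its tail and its
head. -/
def encodeEdge {n : ℕ} (a : Fin n × Fin n) : Val := .cons (.nat a.1) (.nat a.2)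

/-- The input for a weighted directed graph on the vertices `0, …, n - 1`: the number of vertices,
the list of edges, and the list of weights in the order of the vertex numbers. -/
def encodeInput {n : ℕ} (edges : List (Fin n × Fin n)) (w : Fin n → ℝ × ℝ) : Val :=
  .cons (.nat n) (.cons (encodeList (edges.map encodeEdge)) (encodePoints (List.ofFn w)))

/-- With the vertices of `D` numbered by `e`, the list `edges` contains each edge of `D` exactly
once, in some order, and nothing else. -/
def IsEdgeList {V : Type*} {n : ℕ} (D : Digraph V) (e : Fin n ≃ V)
    (edges : List (Fin n × Fin n)) : Prop :=
  edges.Nodup ∧ ∀ i j, (i, j) ∈ edges ↔ D.Adj (e i) (e j)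

/-- Program `P` constructs the polygon of the reachability order of `D` (with the order of `V`)
within `T` steps: for all weights, all numberings of the vertices and all orders of the edge list,
it stops after at most `T` steps and returns the cyclic list of the vertices of the polygon. -/
def Program.ConstructsPolygon (P : Program) {V : Type*} [Fintype V] [PartialOrder V]
    (D : Digraph V) (T : ℝ) : Prop :=
  ∀ (w : V → ℝ × ℝ) (e : Fin (Fintype.card V) ≃ V)
    (edges : List (Fin (Fintype.card V) × Fin (Fintype.card V))), IsEdgeList D e edges →
    ∃ (l : List (ℝ × ℝ)) (t : ℕ),
      P.Computes (encodeInput edges (fun i => w (e i))) (encodePoints l) t ∧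
      IsVertexList l (polygon w) ∧ (t : ℝ) ≤ T

end ParametricClosure

/-! Both parts follow from one quadratic result for all polytrees: at most 4n² vertices, found in
time O(n² log(n+1)). Since log₂(3/2) ≤ 1, the exponent 1 + 1/log₂(3/2) is at least 2 (`sq_le_rpow`),
so part 1 is weaker than this, and oriented paths need no argument of their own.

The recursion is a centroid decomposition. Root the tree at a vertex whose branches have at most n/2
vertices each (`calls_search`, by `treeSums_rotate`), and fix whether the root belongs to the lower
set. This forces other vertices: all predecessors of a root inside the set are inside, all
successors of a root outside it are outside. The forced vertices form a connected region around the
root, and the edges leaving this region impose nothing on their far ends. So, for each of the two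
states, the point set is a translate of the Minkowski sum of the point sets of independent subtrees
(`calls_strip`), with sizes n_i ≤ n/2 and Σ n_i ≤ n - 1.

Only lower boundaries are computed; the upper boundary is the reflected lower boundary for the
weights -w. In a Minkowski sum of convex chains the numbers of edges add (`calls_mink`); in a union
the numbers of points add (`calls_merge`). If each subtree contributes at most 2n_i² points, one
state gives at most 1 + 2Σ n_i² ≤ 1 + n(n-1), and both together at most 2 + 2n(n-1) ≤ 2n²
(`calls_solveTree`). Lower and upper boundary together give 4n².

For the time, the squares of the subtree sizes, summed over both states, stay below n², so each of
the O(log n) levels costs O(n²), provided that the Minkowski sums of one level do. For this the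
subtrees are sorted by descending size: adding a tree of size a to the sum of smaller trees of total
size r costs O(a² + ar + 1) (`calls_solveForest`).

`treeSums_eq_project` links forests to lower sets, and `isVertexList_closeBoundary` turns the two
chains into the cyclic vertex list. The `calls_…` lemmas give for each function of the program its
result and its cost; most also record what the result means. -/

namespace ParametricClosure

open Set
open scoped Pointwise

/-! ### Upward closed convex hulls -/

/-- The points that lie on or vertically above the convex hull of a planar set. -/
def upperHull (X : Set (ℝ × ℝ)) : Set (ℝ × ℝ) :=
  {a | ∃ c ∈ convexHull ℝ X, c.1 = a.1 ∧ c.2 ≤ a.2}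

theorem subset_upperHull (X : Set (ℝ × ℝ)) : X ⊆ upperHull X :=
  fun a ha => ⟨a, subset_convexHull ℝ X ha, rfl, le_rfl⟩

theorem convex_upperHull (X : Set (ℝ × ℝ)) : Convex ℝ (upperHull X) := by
  rintro a ⟨c, hc, h1, h2⟩ b ⟨d, hd, h3, h4⟩ s t hs ht hst
  refine ⟨s • c + t • d, convex_convexHull ℝ X hc hd hs ht hst, ?_, ?_⟩
  · simp [h1, h3]
  · simpa using add_le_add (mul_le_mul_of_nonneg_left h2 hs) (mul_le_mul_of_nonneg_left h4 ht)

theorem upperHull_subset {X C : Set (ℝ × ℝ)} (hC : Convex ℝ C) (hX : X ⊆ C)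
    (hup : ∀ c ∈ C, ∀ a : ℝ × ℝ, c.1 = a.1 → c.2 ≤ a.2 → a ∈ C) : upperHull X ⊆ C := by
  rintro a ⟨c, hc, h1, h2⟩
  exact hup c (convexHull_min hX hC hc) a h1 h2

theorem upperHull_min {X Y : Set (ℝ × ℝ)} (h : X ⊆ upperHull Y) : upperHull X ⊆ upperHull Y :=
  upperHull_subset (convex_upperHull Y) h fun _ ⟨d, hd, h1, h2⟩ _ h3 h4 =>
    ⟨d, hd, h1.trans h3, h2.trans h4⟩

theorem upperHull_mono {X Y : Set (ℝ × ℝ)} (h : X ⊆ Y) : upperHull X ⊆ upperHull Y :=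
  upperHull_min (h.trans (subset_upperHull Y))

theorem add_mem_upperHull {X Y : Set (ℝ × ℝ)} {a b : ℝ × ℝ} (ha : a ∈ upperHull X)
    (hb : b ∈ upperHull Y) : a + b ∈ upperHull (X + Y) := by
  obtain ⟨c, hc, h1, h2⟩ := ha
  obtain ⟨d, hd, h3, h4⟩ := hb
  refine ⟨c + d, ?_, ?_, ?_⟩
  · rw [convexHull_add]
    exact add_mem_add hc hd
  · simp [h1, h3]
  · simpa using add_le_add h2 h4

/-- A clockwise or straight turn at `m` means that `m` lies on or above the chord from `o` to `q`.
The weights `s`, `t` select the point of that chord with the abscissa of `m`. -/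
theorem mem_upperHull_of_orient_nonpos {o m q : ℝ × ℝ} {X : Set (ℝ × ℝ)} (ho : o ∈ upperHull X)
    (hq : q ∈ upperHull X) (h1 : o.1 < m.1) (h2 : m.1 < q.1) (h : orient o m q ≤ 0) :
    m ∈ upperHull X := by
  have hd : 0 < q.1 - o.1 := by linarith
  set s := (q.1 - m.1) / (q.1 - o.1) with hs
  set t := (m.1 - o.1) / (q.1 - o.1) with ht
  have hst : s + t = 1 := by rw [hs, ht]; field_simp; ring
  obtain ⟨c, hc, h3, h4⟩ := convex_upperHull X ho hq (a := s) (b := t)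
    (div_nonneg (by linarith) hd.le) (div_nonneg (by linarith) hd.le) hst
  refine ⟨c, hc, h3.trans ?_, h4.trans ?_⟩
  · simp only [Prod.fst_add, Prod.smul_fst, smul_eq_mul, hs, ht]
    field_simp
    ring
  · simp only [Prod.snd_add, Prod.smul_snd, smul_eq_mul, hs, ht]
    rw [div_mul_eq_mul_div, div_mul_eq_mul_div, ← add_div, div_le_iff₀ hd]
    unfold orient at h
    linarith

theorem mem_upperHull_of_fst_eq {m q : ℝ × ℝ} {X : Set (ℝ × ℝ)} (hq : q ∈ upperHull X)
    (h1 : q.1 = m.1) (h2 : q.2 ≤ m.2) : m ∈ upperHull X :=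
  let ⟨c, hc, h3, h4⟩ := hq
  ⟨c, hc, h3.trans h1, h4.trans h2⟩

/-! ### Strictly convex chains -/

/-- A list of points with strictly increasing abscissas and strictly increasing slopes. -/
structure LowerChain (l : List (ℝ × ℝ)) : Prop where
  sorted : l.Pairwise fun p q => p.1 < q.1
  convex : ∀ p ∈ l, ∀ q ∈ l, ∀ r ∈ l, p.1 < q.1 → q.1 < r.1 → 0 < orient p q r

theorem LowerChain.tail {p : ℝ × ℝ} {l : List (ℝ × ℝ)} (h : LowerChain (p :: l)) :
    LowerChain l :=
  ⟨h.sorted.tail, fun a ha b hb c hc => h.convex a (.tail _ ha) b (.tail _ hb) c (.tail _ hc)⟩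

theorem lowerChain_singleton (p : ℝ × ℝ) : LowerChain [p] :=
  ⟨by simp, by simp⟩

theorem LowerChain.lt_of_mem {p q : ℝ × ℝ} {l : List (ℝ × ℝ)} (h : LowerChain (p :: l))
    (hq : q ∈ l) : p.1 < q.1 :=
  List.rel_of_pairwise_cons h.sorted hq

/-- Slopes increase along `m`, `t`, `q`, `r`, and the slope of a chord is a weighted mean of the
slopes below it. The identities `e1`, `e2` are the denominator-free form. -/
theorem orient_trans {m t q r : ℝ × ℝ} (h1 : m.1 < t.1) (h2 : t.1 < q.1) (h3 : q.1 < r.1)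
    (h4 : 0 < orient m t q) (h5 : 0 < orient t q r) :
    0 < orient m t r ∧ 0 < orient m q r := by
  have e1 : orient m t r * (q.1 - t.1) =
      orient m t q * (r.1 - t.1) + orient t q r * (t.1 - m.1) := by unfold orient; ring
  have e2 : orient m q r * (q.1 - t.1) =
      orient m t q * (r.1 - q.1) + orient t q r * (q.1 - m.1) := by unfold orient; ring
  have hd : 0 < q.1 - t.1 := by linarith
  constructor
  · refine pos_of_mul_pos_left ?_ hd.le
    rw [e1]
    exact add_pos (mul_pos h4 (by linarith)) (mul_pos h5 (by linarith))
  · refine pos_of_mul_pos_left ?_ hd.le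
    rw [e2]
    exact add_pos (mul_pos h4 (by linarith)) (mul_pos h5 (by linarith))

theorem LowerChain.cons {m : ℝ × ℝ} {l : List (ℝ × ℝ)} (hl : LowerChain l)
    (hm : ∀ q ∈ l, m.1 < q.1)
    (h : ∀ q ∈ l, ∀ r ∈ l, q.1 < r.1 → 0 < orient m q r) : LowerChain (m :: l) := by
  refine ⟨List.pairwise_cons.2 ⟨hm, hl.sorted⟩, ?_⟩
  intro a ha b hb c hc hab hbc
  rcases List.mem_cons.1 hb with rfl | hb'
  · rcases List.mem_cons.1 ha with rfl | ha'
    · exact absurd hab (lt_irrefl _)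
    · exact absurd hab (not_lt.2 (hm a ha').le)
  · rcases List.mem_cons.1 hc with rfl | hc'
    · exact absurd hbc (not_lt.2 (hm b hb').le)
    · rcases List.mem_cons.1 ha with rfl | ha'
      · exact h b hb' c hc' hbc
      · exact hl.convex a ha' b hb' c hc' hab hbc

open Classical in
/-- Put the point `m` in front of a chain to its right and remove the points that are no longer
in convex position. -/
noncomputable def push (m : ℝ × ℝ) : List (ℝ × ℝ) → List (ℝ × ℝ)
  | [] => [m]
  | [t] => [m, t]
  | t :: o :: l => if 0 < orient m t o then m :: t :: o :: l else push m (o :: l)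

theorem length_push (m : ℝ × ℝ) (l : List (ℝ × ℝ)) : (push m l).length ≤ l.length + 1 := by
  fun_induction push m l with
  | case1 => simp
  | case2 => simp
  | case3 => simp
  | case4 t o l h ih => simp at ih ⊢; omega

theorem mem_of_mem_push {m x : ℝ × ℝ} {l : List (ℝ × ℝ)} (hx : x ∈ push m l) : x ∈ m :: l := by
  fun_induction push m l with
  | case1 => simpa using hx
  | case2 => simpa using hx
  | case3 => simpa using hx
  | case4 t o l h ih => have := ih hx; simp at this ⊢; tauto

/-- Testing the first turn suffices: by `orient_trans` a left turn at the first remaining point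
makes all later turns seen from `m` left turns. -/
theorem lowerChain_push {m : ℝ × ℝ} {l : List (ℝ × ℝ)} (hl : LowerChain l)
    (hm : ∀ q ∈ l, m.1 < q.1) : LowerChain (push m l) := by
  fun_induction push m l with
  | case1 => exact lowerChain_singleton m
  | case2 t =>
    refine hl.cons hm ?_
    simp
  | case3 t o l h =>
    have key : ∀ q ∈ o :: l, 0 < orient m t q := by
      intro q hq
      rcases List.mem_cons.1 hq with rfl | hq'
      · exact h
      · have h1 := hl.lt_of_mem (List.mem_cons_self (a := o) (l := l))
        have h2 := hl.tail.lt_of_mem hq'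
        exact (orient_trans (hm t (by simp)) h1 h2 h
          (hl.convex _ (by simp) _ (by simp) _ (by simp [hq']) h1 h2)).1
    refine hl.cons hm ?_
    intro q hq r hr hqr
    rcases List.mem_cons.1 hq with rfl | hq'
    · rcases List.mem_cons.1 hr with rfl | hr'
      · exact absurd hqr (lt_irrefl _)
      · exact key r hr'
    · rcases List.mem_cons.1 hr with rfl | hr'
      · exact absurd hqr (not_lt.2 (hl.lt_of_mem hq').le)
      · exact (orient_trans (hm t (by simp)) (hl.lt_of_mem hq') hqr (key q hq')
          (hl.convex _ (by simp) _ hq _ hr (hl.lt_of_mem hq') hqr)).2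
  | case4 t o l h ih => exact ih hl.tail fun q hq => hm q (by simp [hq])

/-- A point is removed only if it lies on or above the chord from `m` to its successor, so nothing
is lost from the upper hull. -/
theorem subset_upperHull_push {m : ℝ × ℝ} {l : List (ℝ × ℝ)} (hl : LowerChain l)
    (hm : ∀ q ∈ l, m.1 < q.1) : {x | x ∈ m :: l} ⊆ upperHull {x | x ∈ push m l} := by
  fun_induction push m l with
  | case1 => exact subset_upperHull _
  | case2 t => exact subset_upperHull _
  | case3 t o l h => exact subset_upperHull _
  | case4 t o l h ih =>
    have ih := ih hl.tail fun q hq => hm q (by simp [hq])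
    intro x hx
    rcases List.mem_cons.1 hx with rfl | hx
    · exact ih (by simp)
    · rcases List.mem_cons.1 hx with rfl | hx
      · exact mem_upperHull_of_orient_nonpos (ih (show m ∈ m :: o :: l by simp))
          (ih (show o ∈ m :: o :: l by simp))
          (hm _ (by simp)) (hl.lt_of_mem (by simp)) (not_lt.1 h)
      · exact ih (List.mem_cons_of_mem _ hx)

/-- `l` is the lower boundary of the convex hull of `A`. -/
structure IsLowerBoundary (l : List (ℝ × ℝ)) (A : Set (ℝ × ℝ)) : Prop where
  chain : LowerChain l
  subset : ∀ p ∈ l, p ∈ A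
  above : A ⊆ upperHull {x | x ∈ l}

theorem isLowerBoundary_singleton (p : ℝ × ℝ) : IsLowerBoundary [p] {p} :=
  ⟨lowerChain_singleton p, by simp, by simpa using subset_upperHull {p} rfl⟩

theorem LowerChain.isLowerBoundary {l : List (ℝ × ℝ)} (h : LowerChain l) :
    IsLowerBoundary l {x | x ∈ l} :=
  ⟨h, fun _ h => h, subset_upperHull _⟩

theorem IsLowerBoundary.push {l : List (ℝ × ℝ)} {A : Set (ℝ × ℝ)} {m : ℝ × ℝ}
    (h : IsLowerBoundary l A) (hm : ∀ q ∈ l, m.1 < q.1) :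
    IsLowerBoundary (push m l) (insert m A) := by
  refine ⟨lowerChain_push h.chain hm, fun p hp => ?_, ?_⟩
  · rcases List.mem_cons.1 (mem_of_mem_push hp) with rfl | hp
    · exact mem_insert _ _
    · exact mem_insert_of_mem _ (h.subset p hp)
  · have hs := subset_upperHull_push h.chain hm
    rw [insert_subset_iff]
    exact ⟨hs (show m ∈ m :: l by simp), h.above.trans (upperHull_min fun x hx =>
      hs (List.mem_cons_of_mem _ hx))⟩

/-- Points on or above the hull may be added freely. This allows unions and Minkowski sums to be
computed from the finite chains alone. -/
theorem IsLowerBoundary.congr {l : List (ℝ × ℝ)} {A B : Set (ℝ × ℝ)}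
    (h : IsLowerBoundary l A) (h1 : A ⊆ B) (h2 : B ⊆ upperHull A) : IsLowerBoundary l B :=
  ⟨h.chain, fun p hp => h1 (h.subset p hp), h2.trans (upperHull_min h.above)⟩

theorem IsLowerBoundary.union {l₁ l₂ l : List (ℝ × ℝ)} {A B : Set (ℝ × ℝ)}
    (h₁ : IsLowerBoundary l₁ A) (h₂ : IsLowerBoundary l₂ B)
    (h : IsLowerBoundary l ({x | x ∈ l₁} ∪ {x | x ∈ l₂})) : IsLowerBoundary l (A ∪ B) :=
  h.congr (union_subset_union h₁.subset h₂.subset) (union_subset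
    (h₁.above.trans (upperHull_mono subset_union_left))
    (h₂.above.trans (upperHull_mono subset_union_right)))

theorem IsLowerBoundary.add {l₁ l₂ l : List (ℝ × ℝ)} {A B : Set (ℝ × ℝ)}
    (h₁ : IsLowerBoundary l₁ A) (h₂ : IsLowerBoundary l₂ B)
    (h : IsLowerBoundary l ({x | x ∈ l₁} + {x | x ∈ l₂})) : IsLowerBoundary l (A + B) := by
  refine h.congr (add_subset_add h₁.subset h₂.subset) ?_
  rintro _ ⟨a, ha, b, hb, rfl⟩
  exact add_mem_upperHull (h₁.above ha) (h₂.above hb)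

theorem IsLowerBoundary.ne_nil {l : List (ℝ × ℝ)} {A : Set (ℝ × ℝ)} (h : IsLowerBoundary l A)
    (hA : A.Nonempty) : l ≠ [] := by
  rintro rfl
  obtain ⟨a, ha⟩ := hA
  obtain ⟨c, hc, -⟩ := h.above ha
  simp at hc

theorem IsLowerBoundary.merge_left {p q : ℝ × ℝ} {l₁ l₂ R : List (ℝ × ℝ)}
    (h₁ : LowerChain (p :: l₁)) (h₂ : LowerChain (q :: l₂)) (hpq : p.1 < q.1)
    (h : IsLowerBoundary R ({x | x ∈ l₁} ∪ {x | x ∈ q :: l₂})) :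
    IsLowerBoundary (ParametricClosure.push p R) ({x | x ∈ p :: l₁} ∪ {x | x ∈ q :: l₂}) := by
  have := h.push (m := p) (fun x hx => by
    rcases h.subset x hx with hx | hx
    · exact h₁.lt_of_mem hx
    · rcases List.mem_cons.1 hx with rfl | hx
      · exact hpq
      · exact hpq.trans (h₂.lt_of_mem hx))
  convert this using 1
  ext x
  simp
  tauto

theorem IsLowerBoundary.merge_skip {p q : ℝ × ℝ} {l₁ l₂ R : List (ℝ × ℝ)}
    (hpq : p.1 = q.1) (hle : p.2 ≤ q.2)
    (h : IsLowerBoundary R ({x | x ∈ p :: l₁} ∪ {x | x ∈ l₂})) :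
    IsLowerBoundary R ({x | x ∈ p :: l₁} ∪ {x | x ∈ q :: l₂}) := by
  refine h.congr (union_subset_union_right _ fun x hx => List.mem_cons_of_mem _ hx) ?_
  rintro x (hx | hx)
  · exact subset_upperHull _ (Or.inl hx)
  · rcases List.mem_cons.1 hx with rfl | hx
    · exact mem_upperHull_of_fst_eq (subset_upperHull _ (Or.inl (by simp))) hpq hle
    · exact subset_upperHull _ (Or.inr hx)

/-- Advancing along the first chain drops the sums `p + b` with `b` in `l₂`. They are recovered from
a parallelogram: if the edge `p p'` is not steeper than the chord from `q` to `b`, then `p + b` lies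
on or above the chord from `p + q` to `p' + b`. -/
theorem IsLowerBoundary.mink_left {p p' q : ℝ × ℝ} {l₁ l₂ R : List (ℝ × ℝ)}
    (h₁ : LowerChain (p :: p' :: l₁)) (h₂ : LowerChain (q :: l₂))
    (hpq : ∀ q' ∈ l₂, 0 ≤ orient (p + q) (p' + q) (p + q'))
    (h : IsLowerBoundary R ({x | x ∈ p' :: l₁} + {x | x ∈ q :: l₂})) :
    IsLowerBoundary (ParametricClosure.push (p + q) R)
      ({x | x ∈ p :: p' :: l₁} + {x | x ∈ q :: l₂}) := by
  have hle : ∀ x ∈ q :: l₂, q.1 ≤ x.1 := by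
    intro x hx
    rcases List.mem_cons.1 hx with rfl | hx
    · exact le_rfl
    · exact (h₂.lt_of_mem hx).le
  refine (h.push (m := p + q) ?_).congr ?_ ?_
  · intro x hx
    obtain ⟨a, ha, b, hb, rfl⟩ := h.subset x hx
    exact add_lt_add_of_lt_of_le (h₁.lt_of_mem ha) (hle b hb)
  · rw [insert_subset_iff]
    exact ⟨add_mem_add (by simp) (by simp),
      add_subset_add_right fun x hx => List.mem_cons_of_mem _ hx⟩
  · rintro _ ⟨a, ha, b, hb, rfl⟩
    rcases List.mem_cons.1 ha with rfl | ha
    · rcases List.mem_cons.1 hb with rfl | hb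
      · exact subset_upperHull _ (mem_insert _ _)
      · refine mem_upperHull_of_orient_nonpos (o := a + q) (q := p' + b)
          (subset_upperHull _ (mem_insert _ _))
          (subset_upperHull _ (mem_insert_of_mem _ (add_mem_add (by simp) (by simp [hb]))))
          ?_ ?_ ?_
        · simpa using h₂.lt_of_mem hb
        · simpa using h₁.lt_of_mem (show p' ∈ p' :: l₁ by simp)
        · have := hpq b hb
          simp only [orient, Prod.fst_add, Prod.snd_add] at this ⊢
          linarith
    · exact subset_upperHull _ (mem_insert_of_mem _ (add_mem_add ha hb))

/-- Chords from `q` get steeper along the second chain, so comparing the two first edges decides the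
hypothesis of `mink_left` for all points. -/
theorem LowerChain.orient_add_nonneg {p p' q q' : ℝ × ℝ} {l₁ l₂ : List (ℝ × ℝ)}
    (h₁ : LowerChain (p :: p' :: l₁)) (h₂ : LowerChain (q :: q' :: l₂))
    (h : 0 ≤ orient (p + q) (p' + q) (p + q')) :
    ∀ x ∈ q' :: l₂, 0 ≤ orient (p + q) (p' + q) (p + x) := by
  intro x hx
  rcases List.mem_cons.1 hx with rfl | hx
  · exact h
  · have h3 : p.1 < p'.1 := h₁.lt_of_mem (by simp)
    have h4 : q.1 < q'.1 := h₂.lt_of_mem (by simp)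
    have h5 : q'.1 < x.1 := h₂.tail.lt_of_mem hx
    have h6 := h₂.convex q (by simp) q' (by simp) x (by simp [hx]) h4 h5
    have e : orient (p + q) (p' + q) (p + x) * (q'.1 - q.1) =
        orient (p + q) (p' + q) (p + q') * (x.1 - q.1) + (p'.1 - p.1) * orient q q' x := by
      simp only [orient, Prod.fst_add, Prod.snd_add]; ring
    have hd : 0 < q'.1 - q.1 := by linarith
    refine nonneg_of_mul_nonneg_left ?_ hd
    rw [e]
    exact add_nonneg (mul_nonneg h (by linarith)) (mul_nonneg (by linarith) h6.le)

/-! ### From the two chains to the list of vertices -/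

theorem LowerChain.eq_of_fst_eq {l : List (ℝ × ℝ)} (h : LowerChain l) {p q : ℝ × ℝ} (hp : p ∈ l)
    (hq : q ∈ l) (hpq : p.1 = q.1) : p = q := by
  obtain ⟨i, hi, rfl⟩ := List.getElem_of_mem hp
  obtain ⟨j, hj, rfl⟩ := List.getElem_of_mem hq
  have := List.pairwise_iff_getElem.1 h.sorted
  rcases lt_trichotomy i j with hij | rfl | hij
  · exact absurd hpq (this i j hi hj hij).ne
  · rfl
  · exact absurd hpq (this j i hj hi hij).ne'

theorem LowerChain.nodup {l : List (ℝ × ℝ)} (h : LowerChain l) : l.Nodup :=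
  h.sorted.imp fun {_ _} hab he => absurd (congrArg Prod.fst he) hab.ne

/-- By convexity every slope from a point on the left to `p` is less than every slope from `p` to a
point on the right; `α` is chosen strictly between these two finite sets. -/
theorem LowerChain.exists_slope {l : List (ℝ × ℝ)} (h : LowerChain l) {p : ℝ × ℝ} (hp : p ∈ l) :
    ∃ α : ℝ, ∀ q ∈ l, q ≠ p → 0 < q.2 - p.2 - α * (q.1 - p.1) := by
  classical
  let slope : ℝ × ℝ → ℝ := fun q => (q.2 - p.2) / (q.1 - p.1)
  obtain ⟨α, h1, h2⟩ := Order.exists_between_finsets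
    ((l.toFinset.filter fun q => q.1 < p.1).image slope)
    ((l.toFinset.filter fun q => p.1 < q.1).image slope) (by
      simp only [Finset.mem_image, Finset.mem_filter, List.mem_toFinset]
      rintro _ ⟨o, ⟨ho, hop⟩, rfl⟩ _ ⟨q, ⟨hq, hpq⟩, rfl⟩
      have := h.convex o ho p hp q hq hop hpq
      have hd : 0 < p.1 - o.1 := by linarith
      have e : slope o = (p.2 - o.2) / (p.1 - o.1) := by
        simp only [slope]; rw [← neg_sub, ← neg_sub p.1, neg_div_neg_eq]
      rw [e, div_lt_div_iff₀ hd (by linarith)]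
      unfold orient at this
      linarith)
  simp only [Finset.mem_image, Finset.mem_filter, List.mem_toFinset] at h1 h2
  refine ⟨α, fun q hq hne => ?_⟩
  rcases lt_trichotomy q.1 p.1 with hlt | heq | hlt
  · have := h1 _ ⟨q, ⟨hq, hlt⟩, rfl⟩
    have hd : q.1 - p.1 < 0 := by linarith
    rw [div_lt_iff_of_neg hd] at this
    linarith
  · exact absurd (h.eq_of_fst_eq hq hp heq) hne
  · have := h2 _ ⟨q, ⟨hq, hlt⟩, rfl⟩
    have hd : 0 < q.1 - p.1 := by linarith
    rw [lt_div_iff₀ hd] at this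
    linarith

/-- The open half-plane above the supporting line, together with `p` itself, is convex and closed
under moving up, so it contains the whole upper hull once it contains the chain. -/
theorem LowerChain.exists_support {l : List (ℝ × ℝ)} (h : LowerChain l) {p : ℝ × ℝ}
    (hp : p ∈ l) : ∃ α : ℝ, ∀ c ∈ upperHull {x | x ∈ l},
      c = p ∨ 0 < c.2 - p.2 - α * (c.1 - p.1) := by
  obtain ⟨α, hα⟩ := h.exists_slope hp
  refine ⟨α, ?_⟩
  refine upperHull_subset (C := {c | c = p ∨ 0 < c.2 - p.2 - α * (c.1 - p.1)}) ?_ ?_ ?_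
  · intro x hx y hy a b ha hb hab
    have e : (a • x + b • y).2 - p.2 - α * ((a • x + b • y).1 - p.1) =
        a * (x.2 - p.2 - α * (x.1 - p.1)) + b * (y.2 - p.2 - α * (y.1 - p.1)) := by
      obtain rfl : b = 1 - a := by linarith
      simp
      ring
    rcases ha.eq_or_lt with rfl | ha
    · obtain rfl : b = 1 := by linarith
      simpa using hy
    rcases hb.eq_or_lt with rfl | hb
    · obtain rfl : a = 1 := by linarith
      simpa using hx
    rcases hx with rfl | hx <;> rcases hy with rfl | hy
    · left
      rw [← add_smul, hab, one_smul]
    all_goals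
      right
      rw [e]
      first | positivity | simpa using by positivity
  · intro q hq
    exact or_iff_not_imp_left.2 (hα q hq)
  · rintro c (rfl | hc) a h1 h2
    · rcases h2.eq_or_lt with h2 | h2
      · exact Or.inl (Prod.ext h1.symm h2.symm)
      · right
        rw [h1]
        linarith
    · right
      rw [← h1]
      linarith

theorem IsLowerBoundary.convexHull_subset {l : List (ℝ × ℝ)} {A : Set (ℝ × ℝ)}
    (h : IsLowerBoundary l A) : convexHull ℝ A ⊆ upperHull {x | x ∈ l} :=
  convexHull_min h.above (convex_upperHull _)

/-- The supporting line at `p` meets the hull in `p` only, so a proper convex combination can equal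
`p` only if both points are `p`. -/
theorem IsLowerBoundary.mem_extremePoints {l : List (ℝ × ℝ)} {A : Set (ℝ × ℝ)}
    (h : IsLowerBoundary l A) {p : ℝ × ℝ} (hp : p ∈ l) :
    p ∈ (convexHull ℝ A).extremePoints ℝ := by
  obtain ⟨α, hα⟩ := h.chain.exists_support hp
  rw [_root_.mem_extremePoints]
  refine ⟨subset_convexHull ℝ A (h.subset p hp), ?_⟩
  rintro x hx y hy ⟨a, b, ha, hb, hab, e⟩
  have e2 : a * (x.2 - p.2 - α * (x.1 - p.1)) + b * (y.2 - p.2 - α * (y.1 - p.1)) = 0 := by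
    have h1 := congrArg Prod.fst e
    have h2 := congrArg Prod.snd e
    obtain rfl : b = 1 - a := by linarith
    simp at h1 h2
    rw [← h1, ← h2]
    ring
  rcases hα x (h.convexHull_subset hx) with rfl | h1 <;>
    rcases hα y (h.convexHull_subset hy) with rfl | h2
  · exact ⟨rfl, rfl⟩
  · simp at e2
    rcases e2 with rfl | e2 <;> linarith
  · simp at e2
    rcases e2 with rfl | e2 <;> linarith
  · have := mul_pos ha h1
    have := mul_pos hb h2
    linarith

theorem IsLowerBoundary.le_snd {l : List (ℝ × ℝ)} {A : Set (ℝ × ℝ)}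
    (h : IsLowerBoundary l A) {p c : ℝ × ℝ} (hp : p ∈ l) (hc : c ∈ convexHull ℝ A)
    (hpc : c.1 = p.1) : p.2 ≤ c.2 := by
  obtain ⟨α, hα⟩ := h.chain.exists_support hp
  rcases hα c (h.convexHull_subset hc) with rfl | h1
  · exact le_rfl
  · rw [hpc] at h1
    linarith

theorem LowerChain.fst_le_of_mem {p x : ℝ × ℝ} {l : List (ℝ × ℝ)} (h : LowerChain (p :: l))
    (hx : x ∈ p :: l) : p.1 ≤ x.1 := by
  rcases List.mem_cons.1 hx with rfl | hx
  · exact le_rfl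
  · exact (h.lt_of_mem hx).le

theorem LowerChain.le_fst_of_mem {p x : ℝ × ℝ} {l : List (ℝ × ℝ)} (h : LowerChain (l ++ [p]))
    (hx : x ∈ l ++ [p]) : x.1 ≤ p.1 := by
  rcases List.mem_append.1 hx with hx | hx
  · exact ((List.pairwise_append.1 h.sorted).2.2 x hx p (by simp)).le
  · simp at hx
    simp [hx]

theorem IsLowerBoundary.fst_le {p : ℝ × ℝ} {l : List (ℝ × ℝ)} {A : Set (ℝ × ℝ)}
    (h : IsLowerBoundary (p :: l) A) : ∀ c ∈ A, p.1 ≤ c.1 := fun _ hc =>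
  upperHull_subset (C := {x | p.1 ≤ x.1})
    ((convex_Ici p.1).linear_preimage (LinearMap.fst ℝ ℝ ℝ))
    (fun _ hx => h.chain.fst_le_of_mem hx) (fun _ h1 _ h2 _ => le_of_le_of_eq h1 h2) (h.above hc)

theorem IsLowerBoundary.le_fst {p : ℝ × ℝ} {l : List (ℝ × ℝ)} {A : Set (ℝ × ℝ)}
    (h : IsLowerBoundary (l ++ [p]) A) : ∀ c ∈ A, c.1 ≤ p.1 := fun _ hc =>
  upperHull_subset (C := {x | x.1 ≤ p.1})
    ((convex_Iic p.1).linear_preimage (LinearMap.fst ℝ ℝ ℝ))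
    (fun _ hx => h.chain.le_fst_of_mem hx) (fun _ h1 _ h2 _ => le_of_eq_of_le h2.symm h1)
    (h.above hc)

theorem convex_orient_nonneg (p q : ℝ × ℝ) : Convex ℝ {r | 0 ≤ orient p q r} := by
  intro x hx y hy a b ha hb hab
  have e : orient p q (a • x + b • y) = a * orient p q x + b * orient p q y := by
    obtain rfl : b = 1 - a := by linarith
    simp [orient]
    ring
  rw [mem_ofPred_eq, e]
  exact add_nonneg (mul_nonneg ha hx) (mul_nonneg hb hy)

theorem IsLowerBoundary.isChain {l : List (ℝ × ℝ)} {A : Set (ℝ × ℝ)} (h : IsLowerBoundary l A) :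
    l.IsChain fun p q => ∀ r ∈ A, 0 ≤ orient p q r := by
  rw [List.isChain_iff_getElem]
  intro i hi r hr
  have hs := List.pairwise_iff_getElem.1 h.chain.sorted
  have hii : l[i].1 < l[i + 1].1 := hs i (i + 1) (by omega) hi (by omega)
  refine upperHull_subset (convex_orient_nonneg _ _) ?_ ?_ (h.above hr)
  · intro x hx
    obtain ⟨j, hj, rfl⟩ := List.getElem_of_mem hx
    rcases lt_or_ge j i with hji | hji
    · have := h.chain.convex _ (List.getElem_mem hj) _ (List.getElem_mem (by omega : i < l.length))
        _ (List.getElem_mem hi) (hs j i hj (by omega) hji) hii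
      simp only [mem_ofPred_eq, orient] at this ⊢
      linarith
    rcases hji.eq_or_lt with rfl | hji
    · simp [orient]
    rcases (Nat.succ_le_of_lt hji).eq_or_lt with rfl | hji
    · exact (by simp only [orient]; ring : orient l[i] l[i + 1] l[i + 1] = 0).ge
    · exact (h.chain.convex _ (List.getElem_mem (by omega : i < l.length)) _ (List.getElem_mem hi)
        _ (List.getElem_mem hj) hii (hs (i + 1) j hi hj (by omega))).le
  · intro c hc a h1 h2
    simp only [mem_ofPred_eq, orient] at hc ⊢
    rw [← h1]
    have := mul_le_mul_of_nonneg_left h2 (sub_pos.2 hii).le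
    linarith

/-- Reflection in the origin preserves orientation. It turns the lower boundary of `-A` into the
upper boundary of `A`, traversed from right to left, which is again counterclockwise. -/
theorem IsLowerBoundary.isChain_neg {l : List (ℝ × ℝ)} {A : Set (ℝ × ℝ)}
    (h : IsLowerBoundary l (-A)) :
    (l.map Neg.neg).IsChain fun p q => ∀ r ∈ A, 0 ≤ orient p q r := by
  rw [List.isChain_map]
  refine h.isChain.imp fun p q hpq r hr => ?_
  have := hpq (-r) (by simpa using hr)
  simp only [orient, Prod.fst_neg, Prod.snd_neg] at this ⊢
  linarith

theorem mem_convexHull_of_between {X : Set (ℝ × ℝ)} {a c d : ℝ × ℝ} (hc : c ∈ convexHull ℝ X)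
    (hd : d ∈ convexHull ℝ X) (h1 : c.1 = a.1) (h2 : d.1 = a.1) (h3 : c.2 ≤ a.2)
    (h4 : a.2 ≤ d.2) : a ∈ convexHull ℝ X := by
  have : a.2 ∈ segment ℝ c.2 d.2 := by
    rw [segment_eq_Icc (h3.trans h4)]
    exact ⟨h3, h4⟩
  obtain ⟨s, t, hs, ht, hst, e⟩ := this
  convert convex_convexHull ℝ X hc hd hs ht hst using 1
  ext
  · obtain rfl : t = 1 - s := by linarith
    simp [h1, h2]
    ring
  · simpa using e.symm

theorem convexHull_subset_of_boundaries {l u : List (ℝ × ℝ)} {A : Set (ℝ × ℝ)}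
    (hl : IsLowerBoundary l A) (hu : IsLowerBoundary u (-A)) :
    convexHull ℝ A ⊆ convexHull ℝ {x | x ∈ l ∨ x ∈ u.map Neg.neg} := by
  refine convexHull_min (fun a ha => ?_) (convex_convexHull ℝ _)
  obtain ⟨c, hc, h1, h2⟩ := hl.above ha
  obtain ⟨d, hd, h3, h4⟩ := hu.above (show -a ∈ -A by simpa using ha)
  refine mem_convexHull_of_between (c := c) (d := -d) (convexHull_mono (fun x hx => Or.inl hx) hc)
    ?_ h1 (by simp [h3]) h2 (by simpa using neg_le_neg h4)
  have : -d ∈ convexHull ℝ (-{x | x ∈ u}) := by rw [convexHull_neg]; simpa using hd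
  refine convexHull_mono (fun x hx => Or.inr ?_) this
  exact List.mem_map.2 ⟨-x, hx, neg_neg x⟩

theorem vertices_eq_of_boundaries {l u : List (ℝ × ℝ)} {A : Set (ℝ × ℝ)}
    (hl : IsLowerBoundary l A) (hu : IsLowerBoundary u (-A)) :
    vertices (convexHull ℝ A) = {x | x ∈ l ∨ x ∈ u.map Neg.neg} := by
  refine Subset.antisymm ?_ ?_
  · have : convexHull ℝ {x | x ∈ l ∨ x ∈ u.map Neg.neg} = convexHull ℝ A := by
      refine Subset.antisymm (convexHull_mono ?_) (convexHull_subset_of_boundaries hl hu)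
      rintro x (hx | hx)
      · exact hl.subset x hx
      · obtain ⟨y, hy, rfl⟩ := List.mem_map.1 hx
        exact hu.subset y hy
    rw [vertices, ← this]
    exact extremePoints_convexHull_subset
  · rintro x (hx | hx)
    · exact hl.mem_extremePoints hx
    · obtain ⟨y, hy, rfl⟩ := List.mem_map.1 hx
      have h := hu.mem_extremePoints hy
      rw [convexHull_neg] at h
      rw [vertices, mem_extremePoints] at *
      refine ⟨h.1, fun a ha b hb hab => ?_⟩
      have := h.2 (-a) (by simpa using ha) (-b) (by simpa using hb) (by
        obtain ⟨s, t, hs, ht, hst, e⟩ := hab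
        exact ⟨s, t, hs, ht, hst, by rw [smul_neg, smul_neg, ← neg_add, e, neg_neg]⟩)
      exact ⟨by rw [← this.1, neg_neg], by rw [← this.2, neg_neg]⟩

/-- A common point of the lower and the upper boundary is an end of the lower boundary. -/
theorem eq_head_or_eq_last {l u : List (ℝ × ℝ)} {A : Set (ℝ × ℝ)}
    (hl : IsLowerBoundary l A) (hu : IsLowerBoundary u (-A)) {a b p : ℝ × ℝ} (ha : a ∈ l)
    (hb : b ∈ l) (hp : p ∈ l) (hpu : -p ∈ u) (h1 : a.1 ≤ p.1) (h2 : p.1 ≤ b.1) :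
    p = a ∨ p = b := by
  by_contra! hne
  have h1 : a.1 < p.1 := lt_of_le_of_ne h1 fun e => hne.1 (hl.chain.eq_of_fst_eq hp ha e.symm)
  have h2 : p.1 < b.1 := lt_of_le_of_ne h2 fun e => hne.2 (hl.chain.eq_of_fst_eq hp hb e)
  obtain ⟨α, hα⟩ := hl.chain.exists_slope hp
  have ha' := hα a ha hne.1.symm
  have hb' := hα b hb hne.2.symm
  have hd : 0 < b.1 - a.1 := by linarith
  set s := (b.1 - p.1) / (b.1 - a.1) with hs
  set t := (p.1 - a.1) / (b.1 - a.1) with ht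
  have hst : s + t = 1 := by rw [hs, ht]; field_simp; ring
  have hs0 : 0 < s := div_pos (by linarith) hd
  have ht0 : 0 < t := div_pos (by linarith) hd
  have hc := convex_convexHull ℝ A (subset_convexHull ℝ A (hl.subset a ha))
    (subset_convexHull ℝ A (hl.subset b hb)) hs0.le ht0.le hst
  have hc1 : (s • a + t • b).1 = p.1 := by
    simp only [Prod.fst_add, Prod.smul_fst, smul_eq_mul, hs, ht]
    field_simp
    ring
  -- As `-p` lies on the lower boundary of `-A`, no point of the hull of `A` is above `p`. But the
  -- chord from `a` to `b` passes strictly above `p`, because both ends lie strictly above the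
  -- supporting line at `p`.
  have := hu.le_snd hpu (c := -(s • a + t • b)) (by rw [convexHull_neg]; simpa using hc)
    (by simp only [Prod.fst_neg]; rw [hc1])
  have h3 := mul_pos hs0 ha'
  have h4 := mul_pos ht0 hb'
  simp at this hc1
  have key : s * (a.2 - p.2 - α * (a.1 - p.1)) + t * (b.2 - p.2 - α * (b.1 - p.1)) =
      s * a.2 + t * b.2 - p.2 := by
    linear_combination (-p.2 + α * p.1) * hst - α * hc1
  linarith

open Classical in
/-- Append `m` to a list, without the last entry of the list if this is `q`. -/
noncomputable def joinAt (q : ℝ × ℝ) (m : List (ℝ × ℝ)) : List (ℝ × ℝ) → List (ℝ × ℝ)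
  | [] => m
  | [p] => if p = q then m else p :: m
  | p :: p' :: l => p :: joinAt q m (p' :: l)

open Classical in
theorem joinAt_append (q : ℝ × ℝ) (m l : List (ℝ × ℝ)) (p : ℝ × ℝ) :
    joinAt q m (l ++ [p]) = l ++ if p = q then m else p :: m := by
  induction l with
  | nil => rfl
  | cons a l ih =>
    cases l with
    | nil => simp [joinAt]
    | cons b l =>
      simp only [List.cons_append] at ih ⊢
      rw [joinAt, ih]

/-- The closed walk along the lower boundary `l` and then the upper boundary `u`, with repeated
points removed. -/
noncomputable def closeBoundary (l u : List (ℝ × ℝ)) : List (ℝ × ℝ) :=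
  match l with
  | [] => []
  | h :: t =>
    match joinAt h [] u with
    | [] => h :: t
    | k :: m => joinAt k (k :: m) (h :: t)

/-- Half-planes are convex, so it suffices to test the points of `A`. The repeated `h` at the end
replaces the cyclic index: the last edge returns to the head. -/
theorem isVertexList_of_isChain {h : ℝ × ℝ} {t : List (ℝ × ℝ)} {A : Set (ℝ × ℝ)}
    (hd : (h :: t).Nodup) (hm : ∀ p, p ∈ h :: t ↔ p ∈ vertices (convexHull ℝ A))
    (hc : (h :: t ++ [h]).IsChain fun p q => ∀ r ∈ A, 0 ≤ orient p q r) :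
    IsVertexList (h :: t) (convexHull ℝ A) := by
  refine ⟨hd, hm, fun i hi r hr => ?_⟩
  refine convexHull_min (fun r hr => ?_) (convex_orient_nonneg _ _) hr
  rw [List.isChain_iff_getElem] at hc
  have := hc i (by simpa using hi) r hr
  rw [List.getElem_append_left hi] at this
  rcases (Nat.succ_le_of_lt hi).eq_or_lt with he | hlt
  · have e : (h :: t)[(i + 1) % (h :: t).length]'(Nat.mod_lt _ (by simp)) = h := by
      have : (i + 1) % (h :: t).length = 0 := by rw [← he]; exact Nat.mod_self _
      simp only [this]
      rfl
    rw [mem_ofPred_eq, e]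
    rw [List.getElem_append_right (by omega)] at this
    simpa using this
  · simp only [mem_ofPred_eq, Nat.mod_eq_of_lt hlt]
    rw [List.getElem_append_left hlt] at this
    exact this

/-- The lower boundary runs from left to right and the upper one back. They are linked by vertical
edges at the extreme abscissas, which may degenerate to points. By `eq_head_or_eq_last` repetitions
occur only there. -/
theorem isVertexList_closeBoundary {l u : List (ℝ × ℝ)} {A : Set (ℝ × ℝ)} (hA : A.Nonempty)
    (hl : IsLowerBoundary l A) (hu : IsLowerBoundary u (-A)) :
    IsVertexList (closeBoundary l (u.map Neg.neg)) (convexHull ℝ A) := by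
  classical
  obtain ⟨li, b, rfl⟩ := l.eq_nil_or_concat'.resolve_left (hl.ne_nil hA)
  obtain ⟨h, t, hht⟩ := List.exists_cons_of_ne_nil (List.append_ne_nil_of_right_ne_nil li
    (List.cons_ne_nil b []))
  obtain ⟨v, s, rfl⟩ := List.exists_cons_of_ne_nil (hu.ne_nil hA.neg)
  obtain ⟨ui, z, huz⟩ := ((v :: s).map Neg.neg).eq_nil_or_concat'.resolve_left (by simp)
  have hh : h ∈ li ++ [b] := by simp [hht]
  have hz : -z ∈ v :: s := by
    have : z ∈ (v :: s).map Neg.neg := by simp [huz]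
    obtain ⟨y, hy, rfl⟩ := List.mem_map.1 this
    simpa using hy
  have hzA : z ∈ A := by simpa using hu.subset _ hz
  have hvA : -v ∈ A := hu.subset v (by simp)
  have hhA := hl.subset h hh
  have hbA := hl.subset b (by simp)
  have hlo : ∀ c ∈ A, h.1 ≤ c.1 := by
    rw [hht] at hl
    exact hl.fst_le
  have hhi : ∀ c ∈ A, c.1 ≤ b.1 := hl.le_fst
  have hhi' : ∀ c ∈ A, c.1 ≤ (-v).1 := fun c hc => by
    have := hu.fst_le (-c) (by simpa using hc)
    simp at this ⊢
    linarith
  have hlo' : ∀ c ∈ A, z.1 ≤ c.1 := fun c hc => by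
    have e : v :: s = ui.map Neg.neg ++ [-z] := by
      have := congrArg (List.map Neg.neg) huz
      simpa using this
    rw [e] at hu
    have := hu.le_fst (-c) (by simpa using hc)
    simpa using this
  have hzh : z.1 = h.1 := le_antisymm (hlo' h hhA) (hlo z hzA)
  have hbv : b.1 = (-v).1 := le_antisymm (hhi' b hbA) (hhi _ hvA)
  have h1 : h.2 ≤ z.2 := hl.le_snd hh (subset_convexHull ℝ A hzA) hzh
  have h2 : b.2 ≤ (-v).2 := hl.le_snd (by simp) (subset_convexHull ℝ A hvA) hbv.symm
  -- The closed walk before repetitions are removed. Its two vertical links are supporting because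
  -- `b` and `h` have extreme abscissas.
  have hchain : ((li ++ [b]) ++ (ui ++ [z]) ++ [h]).IsChain
      fun p q => ∀ r ∈ A, 0 ≤ orient p q r := by
    refine List.IsChain.append (List.IsChain.append hl.isChain (huz ▸ hu.isChain_neg) ?_)
      (List.isChain_singleton h) ?_
    · intro x hx y hy r hr
      simp at hx
      rw [← huz] at hy
      simp at hy
      subst hx hy
      have := mul_nonneg (sub_nonneg.2 h2) (sub_nonneg.2 (hhi r hr))
      simp only [orient, ← hbv]
      linarith
    · intro x hx y hy r hr
      rw [← List.append_assoc] at hx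
      simp only [List.getLast?_concat, Option.mem_def, Option.some.injEq] at hx
      simp at hy
      subst hx hy
      have := mul_nonneg (sub_nonneg.2 h1) (sub_nonneg.2 (hlo r hr))
      simp only [orient, hzh]
      linarith
  have hv := vertices_eq_of_boundaries hl hu
  have hends : ∀ p ∈ li ++ [b], p ∈ ui ++ [z] → p = h ∨ p = b := fun p hp hpu => by
    refine eq_head_or_eq_last hl hu hh (by simp) hp ?_ (hlo p (hl.subset p hp))
      (hhi p (hl.subset p hp))
    rw [← huz] at hpu
    obtain ⟨y, hy, rfl⟩ := List.mem_map.1 hpu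
    simpa using hy
  have hnu : (ui ++ [z]).Nodup := by
    rw [← huz]
    exact hu.chain.nodup.map neg_injective
  have hnl := hl.chain.nodup
  have hmem : ∀ p, p ∈ vertices (convexHull ℝ A) ↔ p ∈ li ++ [b] ∨ p ∈ ui ++ [z] := by
    rw [hv, huz]
    exact fun p => Iff.rfl
  have hvu : ∀ p, p ∈ ui ++ [z] → p = b → ∃ m, ui ++ [z] = b :: m := by
    rintro p hp rfl
    have e : p = -v := by
      rw [← huz] at hp
      obtain ⟨y, hy, rfl⟩ := List.mem_map.1 hp
      congr 1
      refine hu.chain.eq_of_fst_eq hy (by simp) ?_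
      simpa using hbv
    exact ⟨s.map Neg.neg, by rw [← huz, List.map_cons, e]⟩
  have hzu : ∀ p, p ∈ ui ++ [z] → p = h → z = h := by
    rintro p hp rfl
    rw [← huz] at hp
    obtain ⟨y, hy, rfl⟩ := List.mem_map.1 hp
    have : -z = y := hu.chain.eq_of_fst_eq hz hy (by simpa using neg_eq_iff_eq_neg.2 hzh)
    rw [← this, neg_neg]
  have e1 : closeBoundary (li ++ [b]) ((v :: s).map Neg.neg) =
      match ui ++ (if z = h then [] else [z]) with
      | [] => li ++ [b]
      | k :: m => li ++ if b = k then k :: m else b :: k :: m := by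
    rw [hht, closeBoundary, ← hht, huz, joinAt_append]
    cases ui ++ (if z = h then [] else [z]) with
    | nil => rfl
    | cons k m => simp only [joinAt_append]
  rw [e1]
  -- `M` is the upper boundary without its last point if this is the starting point `h`.
  set M := ui ++ (if z = h then [] else [z]) with hM
  have hMc : ((li ++ [b]) ++ M ++ [h]).IsChain fun p q => ∀ r ∈ A, 0 ≤ orient p q r := by
    rw [hM]
    split_ifs with hzh'
    · rw [hzh'] at hchain
      rw [List.append_nil]
      refine hchain.prefix ⟨[h], by simp⟩
    · exact hchain
  have hMn : M.Nodup := by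
    rw [hM]
    split_ifs
    · simpa using (List.nodup_append.1 hnu).1
    · exact hnu
  have hMu : ∀ p ∈ M, p ∈ ui ++ [z] := by
    rw [hM]
    split_ifs <;> simp +contextual
  have huM : ∀ p ∈ ui ++ [z], p ∈ M ∨ p = h := by
    rw [hM]
    intro p hp
    split_ifs with hzh'
    · simpa [hzh'] using hp
    · exact Or.inl hp
  have hMh : ∀ p ∈ M, p ≠ h := by
    intro p hp e
    have := hzu p (hMu p hp) e
    rw [hM, if_pos this, e, ← this, List.append_nil] at hp
    exact (List.nodup_append.1 hnu).2.2 z hp z (by simp) rfl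
  -- Here `m` stands for `M` without `b`; the two uses with nonempty `M` are `M` starting with `b`
  -- and `M` not containing `b`.
  have finish : ∀ m, (∀ p ∈ m, p ∈ M ∧ p ≠ b) → (∀ p ∈ M, p ∈ m ∨ p = b) → m.Nodup →
      ((li ++ [b]) ++ m ++ [h]).IsChain (fun p q => ∀ r ∈ A, 0 ≤ orient p q r) →
      IsVertexList ((li ++ [b]) ++ m) (convexHull ℝ A) := by
    intro m h1 h2 h3 h4
    have h5 : ((li ++ [b]) ++ m).Nodup := by
      refine List.nodup_append.2 ⟨hnl, h3, ?_⟩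
      rintro p hp q hq rfl
      rcases hends p hp (hMu p (h1 p hq).1) with e | e
      · exact hMh p (h1 p hq).1 e
      · exact (h1 p hq).2 e
    have h6 : ∀ p, p ∈ (li ++ [b]) ++ m ↔ p ∈ vertices (convexHull ℝ A) := by
      intro p
      rw [hmem, List.mem_append]
      constructor
      · rintro (hp | hp)
        · exact Or.inl hp
        · exact Or.inr (hMu p (h1 p hp).1)
      · rintro (hp | hp)
        · exact Or.inl hp
        · rcases huM p hp with hp | rfl
          · rcases h2 p hp with hp | rfl
            · exact Or.inr hp
            · simp
          · exact Or.inl hh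
    rw [hht, List.cons_append] at h4 h5 h6 ⊢
    exact isVertexList_of_isChain h5 h6 h4
  cases hMk : M with
  | nil => simpa using finish [] (by simp) (by simp [hMk]) (by simp) (by simpa [hMk] using hMc)
  | cons k m =>
    rw [hMk] at hMn
    by_cases hbk : b = k
    · subst hbk
      have := finish m (fun p hp => ⟨by simp [hMk, hp], by rintro rfl; exact (List.nodup_cons.1 hMn).1 hp⟩)
        (fun p hp => by rw [hMk] at hp; simp at hp; tauto) hMn.of_cons (by
          rw [hMk] at hMc
          have e2 : li ++ [b] ++ m ++ [h] = li ++ b :: (m ++ [h]) := by simp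
          have e3 : li ++ [b] ++ b :: m ++ [h] = (li ++ [b]) ++ b :: (m ++ [h]) := by simp
          rw [e3, List.isChain_split] at hMc
          rw [e2, List.isChain_split]
          exact ⟨hMc.1.prefix ⟨[b], rfl⟩, hMc.2⟩)
      simpa using this
    -- The upper boundary has only one point of maximal abscissa, its first. So if `b` occurred in
    -- it, `M` would start with `b`.
    · have hkb : ∀ p ∈ M, p ≠ b := by
        intro p hp e
        obtain ⟨m', hm'⟩ := hvu p (hMu p hp) e
        have : k :: m <+: b :: m' := by
          rw [← hMk, ← hm', hM]
          split_ifs <;> simp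
        exact hbk (List.cons_prefix_cons.1 this).1.symm
      have := finish M (fun p hp => ⟨hp, hkb p hp⟩) (fun p hp => Or.inl hp) (hMk ▸ hMn) hMc
      rw [hMk] at this
      simpa [hbk] using this

theorem length_joinAt (q : ℝ × ℝ) (m l : List (ℝ × ℝ)) :
    (joinAt q m l).length ≤ l.length + m.length := by
  fun_induction joinAt q m l <;> simp_all; omega

theorem length_closeBoundary (l u : List (ℝ × ℝ)) :
    (closeBoundary l u).length ≤ l.length + u.length := by
  unfold closeBoundary
  cases l with
  | nil => simp
  | cons h t =>
    have h1 := length_joinAt h [] u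
    cases e : joinAt h [] u with
    | nil => simp only [e, List.length_cons]; omega
    | cons k m =>
      have h2 := length_joinAt k (k :: m) (h :: t)
      rw [e] at h1
      simp only [e, List.length_cons, List.length_nil] at h1 h2 ⊢
      omega

/-! ### Rooted forests -/

/-- Ordered rooted forests. The mark of a root tells how the edge from its parent is oriented:
`true` if it is directed from the root to the parent. -/
inductive Forest (α : Type*) where
  | nil
  | node (b : Bool) (x : α) (children siblings : Forest α)

namespace Forest

variable {α β : Type*}

/-- Relabel the vertices. -/
def map (f : α → β) : Forest α → Forest β
  | nil => nil
  | node b x c s => node b (f x) (map f c) (map f s)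

/-- The number of vertices. -/
def size : Forest α → ℕ
  | nil => 0
  | node _ _ c s => 1 + size c + size s

@[simp] theorem size_map (f : α → β) (F : Forest α) : (F.map f).size = F.size := by
  induction F with
  | nil => rfl
  | node b x c s hc hs => simp [map, size, hc, hs]

/-- The vertices in preorder. -/
def verts : Forest α → List α
  | nil => []
  | node _ x c s => x :: (verts c ++ verts s)

theorem length_verts (F : Forest α) : F.verts.length = F.size := by
  induction F with
  | nil => rfl
  | node b x c s hc hs => simp [verts, size, hc, hs]; omega

/-- The directed edge between a parent and a child with the mark `b`. -/
def edge (b : Bool) (parent child : α) : α × α := if b then (child, parent) else (parent, child)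

/-- The directed edges of a forest whose roots are the children of `p`. -/
def edges (p : α) : Forest α → List (α × α)
  | nil => []
  | node b x c s => edge b p x :: (edges x c ++ edges p s)

theorem length_edges (p : α) (F : Forest α) : (F.edges p).length = F.size := by
  induction F generalizing p with
  | nil => rfl
  | node b x c s hc hs => simp [edges, size, hc, hs]; omega

theorem mem_of_mem_edges {p : α} {F : Forest α} {e : α × α} (he : e ∈ F.edges p) :
    e.1 ∈ p :: F.verts ∧ e.2 ∈ p :: F.verts := by
  induction F generalizing p with
  | nil => simp [edges] at he
  | node b x c s hc hs =>
    simp only [edges, List.mem_cons, List.mem_append] at he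
    rcases he with rfl | he | he
    · cases b <;> simp [edge, verts]
    · have := hc he
      simp [verts] at this ⊢
      tauto
    · have := hs he
      simp [verts] at this ⊢
      tauto

/-- The largest tree of the forest has at most `m` vertices. -/
def TreesLE (m : ℕ) : Forest α → Prop
  | nil => True
  | node _ _ c s => 1 + size c ≤ m ∧ TreesLE m s

/-- The trees of the forest are ordered by descending size. -/
def Descending : Forest α → Prop
  | nil => True
  | node _ _ c s => TreesLE (1 + size c) s ∧ Descending s

/-- The sum of the squares of the sizes of the trees. -/
def squares : Forest α → ℕ
  | nil => 0
  | node _ _ c s => (1 + size c) ^ 2 + squares s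

theorem TreesLE.mono {m n : ℕ} (h : m ≤ n) {F : Forest α} (hF : F.TreesLE m) : F.TreesLE n := by
  induction F with
  | nil => trivial
  | node b x c s hc hs => exact ⟨hF.1.trans h, hs hF.2⟩

theorem treesLE_size (F : Forest α) : F.TreesLE F.size := by
  induction F with
  | nil => trivial
  | node b x c s hc hs => exact ⟨by simp [size], hs.mono (by simp [size])⟩

theorem squares_le {m : ℕ} {F : Forest α} (h : F.TreesLE m) : F.squares ≤ m * F.size := by
  induction F with
  | nil => simp [squares]
  | node b x c s hc hs =>
    have h1 := hs h.2
    have h2 := Nat.mul_le_mul_right (1 + c.size) h.1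
    simp only [squares, size]
    nlinarith

/-! ### Sums of closed sets of vertices -/

/-- The sums over a tree with root weight `w` and given state of the root, where `A` is the set of
sums over the subtrees. -/
def rootSums (w : ℝ × ℝ) (s : Bool) (A : Set (ℝ × ℝ)) : Set (ℝ × ℝ) := {if s then w else 0} + A

/-- The weighted sums over the sets of vertices that are closed under predecessors, if the parent
of the roots belongs to the set exactly if `s` is `true`. -/
def sums : Forest (ℝ × ℝ) → Bool → Set (ℝ × ℝ)
  | nil, _ => {0}
  | node b w c r, s => (if b = s then rootSums w s (sums c s) else
      rootSums w true (sums c true) ∪ rootSums w false (sums c false)) + sums r s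

/-- The weighted sums over the closed sets of vertices of a tree with root weight `w`. -/
def treeSums (w : ℝ × ℝ) (F : Forest (ℝ × ℝ)) : Set (ℝ × ℝ) :=
  rootSums w true (sums F true) ∪ rootSums w false (sums F false)

/-- The weighted sums over the closed sets of vertices of unrelated trees. -/
def freeSums : Forest (ℝ × ℝ) → Set (ℝ × ℝ)
  | nil => {0}
  | node _ w c r => treeSums w c + freeSums r

/-- Put the trees of `F` in reverse order in front of `G`. -/
def revAppend : Forest α → Forest α → Forest α
  | nil, G => G
  | node b x c s, G => revAppend s (node b x c G)

theorem size_revAppend (F G : Forest α) : (revAppend F G).size = F.size + G.size := by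
  induction F generalizing G with
  | nil => simp [revAppend, size]
  | node b x c s hc hs => simp [revAppend, size, hs]; omega

theorem sums_revAppend (F G : Forest (ℝ × ℝ)) (s : Bool) :
    (revAppend F G).sums s = F.sums s + G.sums s := by
  induction F generalizing G with
  | nil => simp [revAppend, sums]
  | node b x c r hc hr => rw [revAppend, hr, sums, sums]; ac_rfl

theorem treeSums_congr {w : ℝ × ℝ} {F G : Forest (ℝ × ℝ)} (h : ∀ s, F.sums s = G.sums s) :
    treeSums w F = treeSums w G := by
  simp [treeSums, h]

/-- Moving the root to a child. -/
theorem treeSums_rotate (b : Bool) (w v : ℝ × ℝ) (F G : Forest (ℝ × ℝ)) :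
    treeSums w (node b v F G) = treeSums v (node (!b) w G F) := by
  cases b <;> simp only [treeSums, sums, rootSums, Bool.not_true, Bool.not_false, if_true, if_false,
    Bool.false_eq_true, reduceCtorEq, Set.add_union, Set.union_add] <;>
  · ext x
    simp only [mem_union, add_comm, add_left_comm, add_assoc]
    tauto

/-- The first tree interacts with the remaining vertices only through the edge from `p` to `v`.
Hence a closed set is a closed set of the tree below `v` and one of the other trees, glued along a
compatible pair of states. -/
theorem sums_iff [DecidableEq α] (w : α → ℝ × ℝ) {p : α} {F : Forest α} (hF : (p :: F.verts).Nodup)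
    (s : Bool) (x : ℝ × ℝ) : x ∈ (F.map w).sums s ↔ ∃ χ : α → Bool, χ p = s ∧
      (∀ e ∈ F.edges p, χ e.2 → χ e.1) ∧ x = (F.verts.map fun v => if χ v then w v else 0).sum := by
  induction F generalizing p s x with
  | nil => simpa [map, sums, edges, verts] using fun _ => ⟨fun _ => s, rfl⟩
  | node b v c r hc hr =>
    have hcn : (v :: c.verts).Nodup := by
      simp only [verts, List.nodup_cons, List.nodup_append] at hF ⊢
      exact ⟨fun h => hF.2.1 (List.mem_append_left _ h), hF.2.2.1⟩
    have hrn : (p :: r.verts).Nodup := by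
      simp only [verts, List.nodup_cons, List.nodup_append, List.mem_cons, List.mem_append] at hF ⊢
      exact ⟨fun h => hF.1 (Or.inr (Or.inr h)), hF.2.2.2.1⟩
    -- `s'` is the state of `v`. The two implications say what the edge to `p` allows: `v` is forced
    -- to the state `s` exactly if `b = s`.
    have key : x ∈ ((node b v c r).map w).sums s ↔ ∃ s', (s' = true → b = false → s = true) ∧
        (s = true → b = true → s' = true) ∧
        x ∈ rootSums (w v) s' ((c.map w).sums s') + (r.map w).sums s := by
      simp only [map, sums]
      cases b <;> cases s <;> simp [Set.union_add, or_comm]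
    rw [key]
    constructor
    · rintro ⟨s', h1, h2, _, ⟨_, rfl, y, hy, rfl⟩, z, hz, rfl⟩
      obtain ⟨χ, hχ1, hχ2, rfl⟩ := (hc hcn s' y).1 hy
      obtain ⟨ψ, hψ1, hψ2, rfl⟩ := (hr hrn s z).1 hz
      have hd : ∀ u ∈ p :: r.verts, u ∉ v :: c.verts := by
        intro u hu hu'
        simp only [verts, List.nodup_cons, List.nodup_append, List.mem_cons, List.mem_append]
          at hF hu hu'
        rcases hu with rfl | hu
        · tauto
        · rcases hu' with rfl | hu'
          · tauto
          · exact hF.2.2.2.2 u hu' u hu rfl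
      -- Without repeated vertices the two indicator functions live on disjoint vertex sets, so they
      -- can be glued.
      set φ : α → Bool := fun u => if u ∈ v :: c.verts then χ u else ψ u with hφ
      have e1 : ∀ u ∈ v :: c.verts, φ u = χ u := fun u hu => if_pos hu
      have e2 : ∀ u ∈ p :: r.verts, φ u = ψ u := fun u hu => if_neg (hd u hu)
      refine ⟨φ, (e2 p (by simp)).trans hψ1, ?_, ?_⟩
      · intro e he
        simp only [edges, List.mem_cons, List.mem_append] at he
        rcases he with rfl | he | he
        · have e3 := e1 v (by simp)
          have e4 := e2 p (by simp)
          cases b <;> simp only [edge, if_true, if_false, Bool.false_eq_true, e3, e4, hχ1, hψ1] <;>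
            simp_all
        · have := mem_of_mem_edges he
          rw [e1 _ this.1, e1 _ this.2]
          exact hχ2 e he
        · have := mem_of_mem_edges he
          rw [e2 _ this.1, e2 _ this.2]
          exact hψ2 e he
      · simp only [verts, List.map_cons, List.map_append, List.sum_cons, List.sum_append]
        rw [e1 v (by simp), hχ1, ← add_assoc]
        congr 2
        · congr 1
          exact List.map_congr_left fun u hu => by rw [e1 u (by simp [hu])]
        · exact List.map_congr_left fun u hu => by rw [e2 u (by simp [hu])]
    · rintro ⟨χ, rfl, h, rfl⟩
      refine ⟨χ v, ?_, ?_, ?_⟩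
      · have := h (edge b p v) (by simp [edges])
        rintro h1 rfl
        simpa [edge, h1] using this
      · have := h (edge b p v) (by simp [edges])
        rintro h1 rfl
        simpa [edge, h1] using this
      · simp only [verts, List.map_cons, List.map_append, List.sum_cons, List.sum_append]
        rw [← add_assoc]
        refine add_mem_add (add_mem_add rfl ?_) ?_
        · exact (hc hcn _ _).2 ⟨χ, rfl, fun e he => h e (by simp [edges, he]), rfl⟩
        · exact (hr hrn _ _).2 ⟨χ, rfl, fun e he => h e (by simp [edges, he]), rfl⟩

theorem treeSums_iff [DecidableEq α] (w : α → ℝ × ℝ) {p : α} {F : Forest α}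
    (hF : (p :: F.verts).Nodup) (x : ℝ × ℝ) : x ∈ treeSums (w p) (F.map w) ↔ ∃ χ : α → Bool,
      (∀ e ∈ F.edges p, χ e.2 → χ e.1) ∧
      x = ((p :: F.verts).map fun v => if χ v then w v else 0).sum := by
  simp only [treeSums, rootSums, mem_union, Set.singleton_add, image_add_left, mem_preimage,
    sums_iff w hF]
  constructor
  · rintro (⟨χ, h1, h2, h3⟩ | ⟨χ, h1, h2, h3⟩) <;>
    · refine ⟨χ, h2, ?_⟩
      rw [List.map_cons, List.sum_cons, ← h3, h1]
      simp
  · rintro ⟨χ, h1, rfl⟩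
    cases h : χ p
    · right
      exact ⟨χ, h, h1, by simp [h]⟩
    · left
      exact ⟨χ, h, h1, by simp [h]⟩

end Forest

/-- If the rooted forest `F` below the root `r` spans all vertices and its edges are the edges of
`D`, then its sums are the projected lower sets. -/
theorem treeSums_eq_project {V : Type*} [Fintype V] [PartialOrder V] {D : Digraph V}
    (hD : IsReachabilityOrder D) {ι : Type*} [Fintype ι] [DecidableEq ι] (e : ι ≃ V)
    (w : V → ℝ × ℝ) {r : ι} {F : Forest ι} (hn : (r :: F.verts).Nodup)
    (hv : ∀ i, i ∈ r :: F.verts) (he : ∀ i j, (i, j) ∈ F.edges r ↔ D.Adj (e i) (e j)) :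
    Forest.treeSums (w (e r)) (F.map fun i => w (e i)) = project w (lowerSets V) := by
  classical
  have hsum : ∀ χ : ι → Bool, ((r :: F.verts).map fun i => if χ i then w (e i) else 0).sum =
      ∑ v, {v | χ (e.symm v) = true}.indicator w v := by
    intro χ
    rw [← List.sum_toFinset _ hn]
    have : (r :: F.verts).toFinset = Finset.univ := by
      ext i
      simpa using hv i
    rw [this, ← e.sum_comp]
    exact Finset.sum_congr rfl fun i _ => by simp [indicator_apply]
  ext x
  rw [Forest.treeSums_iff (fun i => w (e i)) hn]
  constructor
  · rintro ⟨χ, h1, rfl⟩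
    refine ⟨{v | χ (e.symm v) = true}, ?_, (hsum χ).symm⟩
    intro u v hvu hu
    have := (hD v u).1 hvu
    induction this using Relation.ReflTransGen.head_induction_on with
    | refl => exact hu
    | head h _ ih =>
      have := h1 (e.symm _, e.symm _) ((he _ _).2 (by simpa using h))
      exact this (ih ((hD _ _).2 ‹_›))
  · rintro ⟨S, hS, rfl⟩
    refine ⟨fun i => decide (e i ∈ S), ?_, ?_⟩
    · rintro ⟨i, j⟩ hij hj
      have := (hD _ _).2 (Relation.ReflTransGen.single ((he i j).1 hij))
      simpa using hS this (by simpa using hj)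
    · rw [hsum]
      congr 1
      ext v
      all_goals simp

end ParametricClosure

namespace ParametricClosure

open scoped Pointwise

/-! ### Symbolic execution -/

/-- A call `f v` of the program `P` stops with the value and the number of steps in `r`. -/
def Runs (P : Program) (f : ℕ) (v : Val) (r : Val × ℕ) : Prop :=
  ∃ body, P[f]? = some body ∧ Eval P [v] body r.1 r.2

open Classical in
/-- The value and the number of steps of a call, if it stops. -/
noncomputable def callVal (P : Program) (f : ℕ) (v : Val) : Option (Val × ℕ) :=
  if h : ∃ r, Runs P f v r then some h.choose else none

theorem callVal_eq_some {P : Program} {f : ℕ} {v : Val} {r : Val × ℕ} :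
    callVal P f v = some r ↔ Runs P f v r := by
  classical
  have hdet : ∀ r s, Runs P f v r → Runs P f v s → r = s := by
    rintro ⟨r, t⟩ ⟨s, u⟩ ⟨b, hb, h⟩ ⟨c, hc, h'⟩
    obtain rfl : b = c := by simpa [hb] using hc
    obtain ⟨h1, h2⟩ := h.deterministic h'
    exact Prod.ext h1 h2
  unfold callVal
  split_ifs with h
  · rw [Option.some_inj]
    exact ⟨fun e => e ▸ h.choose_spec, hdet _ _ h.choose_spec⟩
  · simpa using fun hr => h ⟨r, hr⟩

/-- The number that a value stands for. -/
def Val.toNat? : Val → Option ℕ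
  | .nat k => some k
  | _ => none

/-- The value and the number of steps of an expression, if its evaluation stops. -/
noncomputable def ev (P : Program) : List Val → Expr → Option (Val × ℕ)
  | env, .var i => (env[i]?).map fun v => (v, 1)
  | _, .natConst k => some (.nat k, 1)
  | _, .realConst q => some (.real q, 1)
  | _, .nil => some (.nil, 1)
  | env, .un o e => (ev P env e).bind fun x => (o.run x.1).map fun r => (r, x.2 + 1)
  | env, .bin o e₁ e₂ => (ev P env e₁).bind fun x => (ev P env e₂).bind fun y =>
      (o.run x.1 y.1).map fun r => (r, x.2 + y.2 + 1)
  | env, .ite c e₁ e₂ => (ev P env c).bind fun x => x.1.toNat?.bind fun k =>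
      (if k = 0 then ev P env e₂ else ev P env e₁).map fun y => (y.1, x.2 + y.2 + 1)
  | env, .letIn e₁ e₂ => (ev P env e₁).bind fun x =>
      (ev P (x.1 :: env) e₂).map fun y => (y.1, x.2 + y.2 + 1)
  | env, .call f e => (ev P env e).bind fun x =>
      (callVal P f x.1).map fun y => (y.1, x.2 + y.2 + 1)

/-- `ev` recurses over one function body only and treats inner calls as opaque values `callVal`.
Simplification can thus evaluate a body, given equations for the calls in it; recursion of the
program becomes induction in the proof. -/
theorem ev_sound {P : Program} {env : List Val} {e : Expr} {r : Val × ℕ}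
    (h : ev P env e = some r) : Eval P env e r.1 r.2 := by
  induction e generalizing env r with
  | var i =>
    simp only [ev, Option.map_eq_some_iff] at h
    obtain ⟨v, h, rfl⟩ := h
    exact .var h
  | natConst k => cases h; exact .natConst
  | realConst q => cases h; exact .realConst
  | nil => cases h; exact .nil
  | un o e ih =>
    simp only [ev, Option.bind_eq_some_iff, Option.map_eq_some_iff] at h
    obtain ⟨x, hx, y, hy, rfl⟩ := h
    exact .un (ih hx) hy
  | bin o e₁ e₂ ih₁ ih₂ =>
    simp only [ev, Option.bind_eq_some_iff, Option.map_eq_some_iff] at h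
    obtain ⟨x, hx, y, hy, z, hz, rfl⟩ := h
    exact .bin (ih₁ hx) (ih₂ hy) hz
  | ite c e₁ e₂ ihc ih₁ ih₂ =>
    simp only [ev, Option.bind_eq_some_iff, Option.map_eq_some_iff] at h
    obtain ⟨⟨x, t⟩, hx, k, hk, y, hy, rfl⟩ := h
    obtain rfl : x = .nat k := by
      cases x <;> simp_all [Val.toNat?]
    cases k with
    | zero => exact .iteFalse (ihc hx) (ih₂ hy)
    | succ k => exact .iteTrue (ihc hx) (ih₁ hy)
  | letIn e₁ e₂ ih₁ ih₂ =>
    simp only [ev, Option.bind_eq_some_iff, Option.map_eq_some_iff] at h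
    obtain ⟨x, hx, y, hy, rfl⟩ := h
    exact .letIn (ih₁ hx) (ih₂ hy)
  | call f e ih =>
    simp only [ev, Option.bind_eq_some_iff, Option.map_eq_some_iff] at h
    obtain ⟨x, hx, y, hy, rfl⟩ := h
    obtain ⟨b, hb, hy⟩ := callVal_eq_some.1 hy
    exact .call (ih hx) hb hy

/-- A call of `f` with argument `v` stops after at most `T` steps with the result `r`. -/
def Calls (P : Program) (f : ℕ) (v r : Val) (T : ℕ) : Prop :=
  ∃ t, callVal P f v = some (r, t) ∧ t ≤ T

theorem Calls.mono {P : Program} {f : ℕ} {v r : Val} {T T' : ℕ} (h : Calls P f v r T)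
    (hT : T ≤ T') : Calls P f v r T' :=
  let ⟨t, h1, h2⟩ := h
  ⟨t, h1, h2.trans hT⟩

theorem Calls.of_ev {P : Program} {f : ℕ} {v r : Val} {T : ℕ} {body : Expr}
    (hb : P[f]? = some body) (h : ∃ t, ev P [v] body = some (r, t) ∧ t ≤ T) : Calls P f v r T :=
  let ⟨t, h1, h2⟩ := h
  ⟨t, callVal_eq_some.2 ⟨body, hb, ev_sound h1⟩, h2⟩

/-! ### The program -/

namespace Expr

/-- First field. -/
def hd (e : Expr) : Expr := .un .fst e

/-- Second field. -/
def tl (e : Expr) : Expr := .un .snd e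

/-- Make a record. -/
def pair (a b : Expr) : Expr := .bin .cons a b

/-- Branch on whether `c` is a record. -/
def ifCons (c a b : Expr) : Expr := .ite (.un .isCons c) a b

/-- Call with two arguments. -/
def call₂ (f : ℕ) (a b : Expr) : Expr := .call f (pair a b)

/-- Call with three arguments. -/
def call₃ (f : ℕ) (a b c : Expr) : Expr := .call f (pair a (pair b c))

/-- Call with four arguments. -/
def call₄ (f : ℕ) (a b c d : Expr) : Expr := .call f (pair a (pair b (pair c d)))

/-- The argument of a function. -/
def arg : Expr := .var 0

/-- Function 0, with the arguments `n, edges, weights`. -/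
def mainBody : Expr :=
  .letIn (.call 4 (tl (tl arg))) <|
  .letIn (.call₂ 14 (hd (tl (tl (.var 1))))
    (hd (call₃ 3 (.natConst 0) (hd (tl (.var 1))) (tl (tl (.var 1)))))) <|
  .letIn (.call 4 (.call₂ 14 (hd (.var 1))
    (hd (call₃ 3 (.natConst 0) (hd (tl (.var 2))) (.var 1))))) <|
  .letIn (call₃ 15 (hd (.var 1)) .nil (.var 0)) <|
  ifCons (.var 0) (call₃ 15 (hd (.var 0)) (.var 0) (.var 2)) (.var 2)

/-- Function 1: find an edge at the vertex `v` in a list of edges, and remove it. -/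
def findBody : Expr :=
  ifCons (tl arg)
    (.ite (.bin .natEq (hd arg) (hd (hd (tl arg))))
      (pair (pair (.natConst 0) (tl (hd (tl arg)))) (tl (tl arg)))
      (.ite (.bin .natEq (hd arg) (tl (hd (tl arg))))
        (pair (pair (.natConst 1) (hd (hd (tl arg)))) (tl (tl arg)))
        (.letIn (call₂ 1 (hd arg) (tl (tl arg)))
          (ifCons (.var 0) (pair (hd (.var 0)) (pair (hd (tl (.var 1))) (tl (.var 0)))) .nil))))
    .nil

/-- Function 2: entry `i` of a list. -/
def lookupBody : Expr :=
  .ite (.bin .natEq (hd arg) (.natConst 0)) (hd (tl arg))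
    (call₂ 2 (.bin .natSub (hd arg) (.natConst 1)) (tl (tl arg)))

/-- Function 3, with the arguments `v, edges, weights`: the forest below `v`, and the edges that
do not belong to it. -/
def buildBody : Expr :=
  .letIn (call₂ 1 (hd arg) (hd (tl arg))) <|
  ifCons (.var 0)
    (.letIn (call₃ 3 (tl (hd (.var 0))) (tl (.var 0)) (tl (tl (.var 1)))) <|
     .letIn (call₃ 3 (hd (.var 2)) (tl (.var 0)) (tl (tl (.var 2)))) <|
     pair (pair (pair (hd (hd (.var 2))) (call₂ 2 (tl (hd (.var 2))) (tl (tl (.var 3)))))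
       (pair (hd (.var 1)) (hd (.var 0)))) (tl (.var 0)))
    (pair .nil (hd (tl (.var 1))))

/-- Function 4: reflect a list of points in the origin. -/
def negBody : Expr :=
  ifCons arg
    (pair (pair (.bin .realSub (.realConst 0) (hd (hd arg)))
      (.bin .realSub (.realConst 0) (tl (hd arg)))) (.call 4 (tl arg))) .nil

/-- Function 5: the size of a forest. -/
def sizeBody : Expr :=
  ifCons arg
    (.bin .natAdd (.bin .natAdd (.natConst 1) (.call 5 (hd (tl arg)))) (.call 5 (tl (tl arg))))
    (.natConst 0)

/-- Function 6: put a forest in reverse order in front of another one. -/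
def revBody : Expr :=
  ifCons (hd arg)
    (call₂ 6 (tl (tl (hd arg))) (pair (hd (hd arg)) (pair (hd (tl (hd arg))) (tl arg))))
    (tl arg)

/-- Function 7: move the root of a tree to the centroid. The arguments are the number of vertices,
the weight of the root, and the subtrees that have, or have not yet, been found to be small. -/
def searchBody : Expr :=
  ifCons (tl (tl (tl arg)))
    (.letIn (.bin .natAdd (.call 5 (hd (tl (tl (tl (tl arg)))))) (.natConst 1)) <|
      .ite (.bin .natLt (hd (.var 1)) (.bin .natAdd (.var 0) (.var 0)))
        (call₄ 7 (hd (.var 1)) (tl (hd (tl (tl (tl (.var 1))))))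
          (pair (pair (.bin .natSub (.natConst 1) (hd (hd (tl (tl (tl (.var 1)))))))
            (hd (tl (.var 1))))
            (pair (call₂ 6 (hd (tl (tl (.var 1)))) (tl (tl (tl (tl (tl (.var 1)))))))
              .nil))
          (hd (tl (tl (tl (tl (.var 1)))))))
        (call₄ 7 (hd (.var 1)) (hd (tl (.var 1)))
          (pair (hd (tl (tl (tl (.var 1)))))
            (pair (hd (tl (tl (tl (tl (.var 1)))))) (hd (tl (tl (.var 1))))))
          (tl (tl (tl (tl (tl (.var 1))))))))
    (pair (hd (tl arg)) (hd (tl (tl arg))))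

/-- Function 8: insert a tree into a forest that is ordered by descending size. -/
def insertBody : Expr :=
  ifCons (tl arg)
    (.ite (.bin .natLt (.call 5 (tl (hd arg))) (.call 5 (hd (tl (tl arg)))))
      (pair (hd (tl arg)) (pair (hd (tl (tl arg))) (call₂ 8 (hd arg) (tl (tl (tl arg))))))
      (pair (pair (.natConst 0) (hd (hd arg))) (pair (tl (hd arg)) (tl arg))))
    (pair (pair (.natConst 0) (hd (hd arg))) (pair (tl (hd arg)) (tl arg)))

/-- Function 9, with the arguments `s, F, x, L`: remove the vertices of the forest `F` whose state
is determined by the state `s` of the parent of the roots; add their weights to `x`, and the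
remaining trees to the forest `L`. -/
def stripBody : Expr :=
  ifCons (hd (tl arg))
    (.ite (.bin .natEq (hd (hd (hd (tl arg)))) (hd arg))
      (call₃ 9 (hd arg) (tl (tl (hd (tl arg))))
        (call₄ 9 (hd arg) (hd (tl (hd (tl arg))))
          (.ite (hd arg) (call₂ 16 (tl (hd (hd (tl arg)))) (hd (tl (tl arg))))
            (hd (tl (tl arg))))
          (tl (tl (tl arg)))))
      (call₄ 9 (hd arg) (tl (tl (hd (tl arg)))) (hd (tl (tl arg)))
        (call₂ 8 (pair (tl (hd (hd (tl arg)))) (hd (tl (hd (tl arg))))) (tl (tl (tl arg))))))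
    (tl (tl arg))

/-- Function 10: put a point in front of a chain. -/
def pushBody : Expr :=
  ifCons (tl arg)
    (ifCons (tl (tl arg))
      (.ite (call₃ 17 (hd arg) (hd (tl arg)) (hd (tl (tl arg)))) arg
        (call₂ 10 (hd arg) (tl (tl arg))))
      arg)
    arg

/-- The first step of a Minkowski sum, along the first chain. -/
def minkLeft : Expr :=
  call₂ 10 (call₂ 16 (hd (hd arg)) (hd (tl arg))) (call₂ 11 (tl (hd arg)) (tl arg))

/-- The first step of a Minkowski sum, along the second chain. -/
def minkRight : Expr :=
  call₂ 10 (call₂ 16 (hd (hd arg)) (hd (tl arg))) (call₂ 11 (hd arg) (tl (tl arg)))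

/-- Function 11: the Minkowski sum of two chains. -/
def minkBody : Expr :=
  ifCons (tl (hd arg))
    (ifCons (tl (tl arg))
      (.ite (call₃ 17 (call₂ 16 (hd (hd arg)) (hd (tl arg)))
        (call₂ 16 (hd (tl (hd arg))) (hd (tl arg)))
        (call₂ 16 (hd (hd arg)) (hd (tl (tl arg))))) minkLeft minkRight)
      minkLeft)
    (ifCons (tl (tl arg)) minkRight (pair (call₂ 16 (hd (hd arg)) (hd (tl arg))) .nil))

/-- Function 12: the lower boundary of the union of two chains. -/
def mergeBody : Expr :=
  ifCons (hd arg)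
    (ifCons (tl arg)
      (.ite (.bin .realLt (hd (hd (hd arg))) (hd (hd (tl arg))))
        (call₂ 10 (hd (hd arg)) (call₂ 12 (tl (hd arg)) (tl arg)))
        (.ite (.bin .realLt (hd (hd (tl arg))) (hd (hd (hd arg))))
          (call₂ 10 (hd (tl arg)) (call₂ 12 (hd arg) (tl (tl arg))))
          (.ite (.bin .realLt (tl (hd (hd arg))) (tl (hd (tl arg))))
            (call₂ 12 (hd arg) (tl (tl arg)))
            (call₂ 12 (tl (hd arg)) (tl arg)))))
      (hd arg))
    (tl arg)

/-- Function 13: the lower boundary for a list of unrelated trees, translated by a vector. -/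
def solveForestBody : Expr :=
  ifCons (hd arg)
    (call₂ 11 (call₂ 14 (tl (hd (hd arg))) (hd (tl (hd arg))))
      (call₂ 13 (tl (tl (hd arg))) (tl arg)))
    (pair (tl arg) .nil)

/-- Function 14: the lower boundary for a tree. -/
def solveTreeBody : Expr :=
  .letIn (call₄ 7 (.bin .natAdd (.call 5 (tl arg)) (.natConst 1)) (hd arg) .nil (tl arg)) <|
  .letIn (call₄ 9 (.natConst 1) (tl (.var 0)) (hd (.var 0)) .nil) <|
  .letIn (call₄ 9 (.natConst 0) (tl (.var 1)) (pair (.realConst 0) (.realConst 0)) .nil) <|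
  call₂ 12 (call₂ 13 (tl (.var 1)) (hd (.var 1))) (call₂ 13 (tl (.var 0)) (hd (.var 0)))

/-- Function 15, with the arguments `q, m, l`: append `m` to `l`, without the last entry of `l` if
this is `q`. -/
def joinBody : Expr :=
  ifCons (tl (tl arg))
    (ifCons (tl (tl (tl arg)))
      (pair (hd (tl (tl arg))) (call₃ 15 (hd arg) (hd (tl arg)) (tl (tl (tl arg)))))
      (.ite (call₂ 18 (hd (tl (tl arg))) (hd arg)) (hd (tl arg))
        (pair (hd (tl (tl arg))) (hd (tl arg)))))
    (hd (tl arg))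

/-- Function 16: add two vectors. -/
def addBody : Expr :=
  pair (.bin .realAdd (hd (hd arg)) (hd (tl arg))) (.bin .realAdd (tl (hd arg)) (tl (tl arg)))

/-- Function 17: test for a left turn at the second of three points. -/
def turnBody : Expr :=
  .bin .realLt
    (.bin .realMul (.bin .realSub (tl (hd (tl arg))) (tl (hd arg)))
      (.bin .realSub (hd (tl (tl arg))) (hd (hd arg))))
    (.bin .realMul (.bin .realSub (hd (hd (tl arg))) (hd (hd arg)))
      (.bin .realSub (tl (tl (tl arg))) (tl (hd arg))))

/-- Function 18: test whether two points are equal. -/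
def eqBody : Expr :=
  .ite (.bin .realLt (hd (hd arg)) (hd (tl arg))) (.natConst 0)
    (.ite (.bin .realLt (hd (tl arg)) (hd (hd arg))) (.natConst 0)
      (.ite (.bin .realLt (tl (hd arg)) (tl (tl arg))) (.natConst 0)
        (.ite (.bin .realLt (tl (tl arg)) (tl (hd arg))) (.natConst 0) (.natConst 1))))

end Expr

open ParametricClosure.Expr in
/-- The program that constructs the polygon of a polytree. -/
def prog : Program :=
  [mainBody, findBody, lookupBody, buildBody, negBody, sizeBody, revBody, searchBody, insertBody,
    stripBody, pushBody, minkBody, mergeBody, solveForestBody, solveTreeBody, joinBody, addBody,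
    turnBody, eqBody]

attribute [local simp] ev Expr.hd Expr.tl Expr.pair Expr.ifCons Expr.call₂ Expr.call₃ Expr.call₄
  Expr.arg UnOp.run BinOp.run Val.toNat?

@[simp] theorem encodePoints_nil : encodePoints [] = .nil := rfl

@[simp] theorem encodePoints_cons (p : ℝ × ℝ) (l : List (ℝ × ℝ)) :
    encodePoints (p :: l) = .cons (encodePoint p) (encodePoints l) := rfl

/-! ### Points -/

theorem calls_add (p q : ℝ × ℝ) :
    Calls prog 16 (.cons (encodePoint p) (encodePoint q)) (encodePoint (p + q)) 20 := by
  refine .of_ev (body := Expr.addBody) rfl ?_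
  simp [Expr.addBody, encodePoint]

open Classical in
theorem calls_turn (p q r : ℝ × ℝ) :
    Calls prog 17 (.cons (encodePoint p) (.cons (encodePoint q) (encodePoint r)))
      (.nat (if 0 < orient p q r then 1 else 0)) 40 := by
  refine .of_ev (body := Expr.turnBody) rfl ?_
  simp [Expr.turnBody, encodePoint, orient]

open Classical in
theorem calls_eq (p q : ℝ × ℝ) :
    Calls prog 18 (.cons (encodePoint p) (encodePoint q)) (.nat (if p = q then 1 else 0)) 40 := by
  refine .of_ev (body := Expr.eqBody) rfl ?_
  obtain ⟨a, b⟩ := p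
  obtain ⟨c, d⟩ := q
  rcases lt_trichotomy a c with h1 | rfl | h1
  · simp [Expr.eqBody, encodePoint, h1, h1.ne]
  · rcases lt_trichotomy b d with h2 | rfl | h2
    · simp [Expr.eqBody, encodePoint, h2, h2.ne]
    · simp [Expr.eqBody, encodePoint]
    · simp [Expr.eqBody, encodePoint, h2, h2.ne', h2.not_gt]
  · simp [Expr.eqBody, encodePoint, h1, h1.ne', h1.not_gt]

theorem calls_neg (l : List (ℝ × ℝ)) :
    Calls prog 4 (encodePoints l) (encodePoints (l.map Neg.neg)) (25 * l.length + 25) := by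
  refine .of_ev (body := Expr.negBody) rfl ?_
  induction l with
  | nil => simp [Expr.negBody]
  | cons p l ih =>
    obtain ⟨t, h1, h2⟩ := Calls.of_ev (f := 4) (body := Expr.negBody) rfl ih
    simp [Expr.negBody, encodePoint, h1]
    omega

/-! ### Chains -/

/-- Amortised cost: every removed point pays for the step that removes it. The length of the result
acts as a potential. -/
theorem calls_push (m : ℝ × ℝ) (l : List (ℝ × ℝ)) : ∃ T,
    Calls prog 10 (.cons (encodePoint m) (encodePoints l)) (encodePoints (push m l)) T ∧
      T + 100 * (push m l).length ≤ 100 * (l.length + 2) := by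
  fun_induction push m l with
  | case1 =>
    refine ⟨100, .of_ev (body := Expr.pushBody) rfl ?_, by simp⟩
    simp [Expr.pushBody]
  | case2 t =>
    refine ⟨100, .of_ev (body := Expr.pushBody) rfl ?_, by simp⟩
    simp [Expr.pushBody]
  | case3 t o l h =>
    refine ⟨100, .of_ev (body := Expr.pushBody) rfl ?_, by simp; omega⟩
    obtain ⟨t1, h1, h2⟩ := calls_turn m t o
    simp [Expr.pushBody, h1, h]
    omega
  | case4 t o l h ih =>
    obtain ⟨T, ⟨t2, h3, h4⟩, h5⟩ := ih
    refine ⟨T + 100, .of_ev (body := Expr.pushBody) rfl ?_, by simp at h5 ⊢; omega⟩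
    obtain ⟨t1, h1, h2⟩ := calls_turn m t o
    simp at h3
    simp [Expr.pushBody, h1, h, h3]
    omega

theorem calls_mink_left {p q : ℝ × ℝ} {l₁ l₂ R : List (ℝ × ℝ)} {T : ℕ} (h : Calls prog 11
      (.cons (encodePoints l₁) (encodePoints (q :: l₂))) (encodePoints R) T) :
    ∃ t, ev prog [.cons (encodePoints (p :: l₁)) (encodePoints (q :: l₂))] Expr.minkLeft =
      some (encodePoints (push (p + q) R), t) ∧
      t + 100 * (push (p + q) R).length ≤ T + 100 * R.length + 260 := by
  obtain ⟨t, h1, h2⟩ := h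
  obtain ⟨T', ⟨t', h3, h4⟩, h5⟩ := calls_push (p + q) R
  obtain ⟨t₃, h6, h7⟩ := calls_add p q
  simp at h1
  simp [Expr.minkLeft, h1, h3, h6]
  omega

theorem calls_mink_right {p q : ℝ × ℝ} {l₁ l₂ R : List (ℝ × ℝ)} {T : ℕ} (h : Calls prog 11
      (.cons (encodePoints (p :: l₁)) (encodePoints l₂)) (encodePoints R) T) :
    ∃ t, ev prog [.cons (encodePoints (p :: l₁)) (encodePoints (q :: l₂))] Expr.minkRight =
      some (encodePoints (push (p + q) R), t) ∧
      t + 100 * (push (p + q) R).length ≤ T + 100 * R.length + 260 := by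
  obtain ⟨t, h1, h2⟩ := h
  obtain ⟨T', ⟨t', h3, h4⟩, h5⟩ := calls_push (p + q) R
  obtain ⟨t₃, h6, h7⟩ := calls_add p q
  simp at h1
  simp [Expr.minkRight, h1, h3, h6]
  omega

theorem IsLowerBoundary.mink_right {p q q' : ℝ × ℝ} {l₁ l₂ R : List (ℝ × ℝ)}
    (h₁ : LowerChain (p :: l₁)) (h₂ : LowerChain (q :: q' :: l₂))
    (hpq : ∀ p' ∈ l₁, 0 ≤ orient (q + p) (q' + p) (q + p'))
    (h : IsLowerBoundary R ({x | x ∈ p :: l₁} + {x | x ∈ q' :: l₂})) :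
    IsLowerBoundary (ParametricClosure.push (p + q) R)
      ({x | x ∈ p :: l₁} + {x | x ∈ q :: q' :: l₂}) := by
  rw [add_comm] at h
  rw [add_comm p q, add_comm {x | x ∈ p :: l₁}]
  exact h.mink_left h₂ h₁ hpq

/-- A merge of the edges by slope, where `push` also removes collinear points. The potential of 600
per output point pays for later removals. The saved point in the length bound keeps the number of
edges additive under repeated sums. -/
theorem calls_mink {l₁ l₂ : List (ℝ × ℝ)} (h₁ : LowerChain l₁) (h₂ : LowerChain l₂) (n₁ : l₁ ≠ [])
    (n₂ : l₂ ≠ []) : ∃ R T, Calls prog 11 (.cons (encodePoints l₁) (encodePoints l₂))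
      (encodePoints R) T ∧ IsLowerBoundary R ({x | x ∈ l₁} + {x | x ∈ l₂}) ∧
      R.length + 1 ≤ l₁.length + l₂.length ∧
      T + 600 * R.length ≤ 1200 * (l₁.length + l₂.length) := by
  induction hn : l₁.length + l₂.length using Nat.strong_induction_on generalizing l₁ l₂ with
  | _ n ih =>
  subst hn
  obtain ⟨p, l₁, rfl⟩ := List.exists_cons_of_ne_nil n₁
  obtain ⟨q, l₂, rfl⟩ := List.exists_cons_of_ne_nil n₂
  have left : ∀ p' r, l₁ = p' :: r → (∀ q' ∈ l₂, 0 ≤ orient (p + q) (p' + q) (p + q')) →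
      ∃ R t, ev prog [.cons (encodePoints (p :: l₁)) (encodePoints (q :: l₂))] Expr.minkLeft =
        some (encodePoints R, t) ∧ IsLowerBoundary R ({x | x ∈ p :: l₁} + {x | x ∈ q :: l₂}) ∧
      R.length + 1 ≤ (p :: l₁).length + (q :: l₂).length ∧
      t + 600 * R.length + 200 ≤ 1200 * ((p :: l₁).length + (q :: l₂).length) := by
    rintro p' r rfl ho
    obtain ⟨R, T, h3, h4, h5, h6⟩ := ih _ (by simp) h₁.tail h₂ (by simp) (by simp) rfl
    obtain ⟨t, h7, h8⟩ := calls_mink_left (p := p) h3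
    have := length_push (p + q) R
    refine ⟨_, t, h7, h4.mink_left h₁ h₂ ho, ?_, ?_⟩ <;> simp at h5 h6 ⊢ <;> omega
  have right : ∀ q' r, l₂ = q' :: r → (∀ p' ∈ l₁, 0 ≤ orient (q + p) (q' + p) (q + p')) →
      ∃ R t, ev prog [.cons (encodePoints (p :: l₁)) (encodePoints (q :: l₂))] Expr.minkRight =
        some (encodePoints R, t) ∧ IsLowerBoundary R ({x | x ∈ p :: l₁} + {x | x ∈ q :: l₂}) ∧
      R.length + 1 ≤ (p :: l₁).length + (q :: l₂).length ∧
      t + 600 * R.length + 200 ≤ 1200 * ((p :: l₁).length + (q :: l₂).length) := by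
    rintro q' r rfl ho
    obtain ⟨R, T, h3, h4, h5, h6⟩ := ih _ (by simp) h₁ h₂.tail (by simp) (by simp) rfl
    obtain ⟨t, h7, h8⟩ := calls_mink_right (q := q) h3
    have := length_push (p + q) R
    refine ⟨_, t, h7, h4.mink_right h₁ h₂ ho, ?_, ?_⟩ <;> simp at h5 h6 ⊢ <;> omega
  cases hl₁ : l₁ with
  | nil =>
    cases hl₂ : l₂ with
    | nil =>
      obtain ⟨t, h3, h4⟩ := calls_add p q
      refine ⟨[p + q], 600, .of_ev (body := Expr.minkBody) rfl ?_, ?_, by simp, by simp⟩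
      · simp [Expr.minkBody, h3]
        omega
      · simpa using isLowerBoundary_singleton (p + q)
    | cons q' r =>
      obtain ⟨R, t, h3, h4, h5, h6⟩ := right q' r hl₂ (by simp [hl₁])
      rw [← hl₁, ← hl₂]
      refine ⟨R, t + 200, .of_ev (body := Expr.minkBody) rfl ?_, h4, h5, by omega⟩
      simp [hl₁, hl₂] at h3
      simp [Expr.minkBody, h3, hl₁, hl₂]
      omega
  | cons p' r₁ =>
    cases hl₂ : l₂ with
    | nil =>
      obtain ⟨R, t, h3, h4, h5, h6⟩ := left p' r₁ hl₁ (by simp [hl₂])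
      rw [← hl₁, ← hl₂]
      refine ⟨R, t + 200, .of_ev (body := Expr.minkBody) rfl ?_, h4, h5, by omega⟩
      simp [hl₁, hl₂] at h3
      simp [Expr.minkBody, h3, hl₁, hl₂]
      omega
    | cons q' r₂ =>
      obtain ⟨t₁, h7, h8⟩ := calls_add p q
      obtain ⟨t₂, h9, h10⟩ := calls_add p' q
      obtain ⟨t₃, h11, h12⟩ := calls_add p q'
      obtain ⟨t₄, h13, h14⟩ := calls_turn (p + q) (p' + q) (p + q')
      by_cases ho : 0 < orient (p + q) (p' + q) (p + q')
      · obtain ⟨R, t, h3, h4, h5, h6⟩ := left p' r₁ hl₁ (by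
          rw [hl₁] at h₁
          rw [hl₂] at h₂ ⊢
          exact h₁.orient_add_nonneg h₂ ho.le)
        rw [← hl₁, ← hl₂]
        refine ⟨R, t + 200, .of_ev (body := Expr.minkBody) rfl ?_, h4, h5, by omega⟩
        simp [hl₁, hl₂] at h3
        simp [Expr.minkBody, h3, hl₁, hl₂, h7, h9, h11, h13, ho]
        omega
      · obtain ⟨R, t, h3, h4, h5, h6⟩ := right q' r₂ hl₂ (by
          rw [hl₂] at h₂
          rw [hl₁] at h₁ ⊢
          refine h₂.orient_add_nonneg h₁ ?_
          rw [not_lt] at ho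
          simp only [orient, Prod.fst_add, Prod.snd_add] at ho ⊢
          linarith)
        rw [← hl₁, ← hl₂]
        refine ⟨R, t + 200, .of_ev (body := Expr.minkBody) rfl ?_, h4, h5, by omega⟩
        simp [hl₁, hl₂] at h3
        simp [Expr.minkBody, h3, hl₁, hl₂, h7, h9, h11, h13, ho]
        omega

theorem calls_merge {l₁ l₂ : List (ℝ × ℝ)} (h₁ : LowerChain l₁) (h₂ : LowerChain l₂) :
    ∃ R T, Calls prog 12 (.cons (encodePoints l₁) (encodePoints l₂))
      (encodePoints R) T ∧ IsLowerBoundary R ({x | x ∈ l₁} ∪ {x | x ∈ l₂}) ∧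
      R.length ≤ l₁.length + l₂.length ∧
      T + 600 * R.length ≤ 1200 * (l₁.length + l₂.length) + 600 := by
  induction hn : l₁.length + l₂.length using Nat.strong_induction_on generalizing l₁ l₂ with
  | _ n ih =>
  subst hn
  cases l₁ with
  | nil =>
    refine ⟨l₂, 600, .of_ev (body := Expr.mergeBody) rfl ?_, ?_, by simp, by simp; omega⟩
    · simp [Expr.mergeBody]
    · simpa using h₂.isLowerBoundary
  | cons p l₁ =>
  cases l₂ with
  | nil =>
    refine ⟨p :: l₁, 600, .of_ev (body := Expr.mergeBody) rfl ?_, ?_, by simp, by simp; omega⟩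
    · simp [Expr.mergeBody]
    · simpa using h₁.isLowerBoundary
  | cons q l₂ =>
  -- Both possible recursive calls are prepared; the comparison of the first points selects one.
  -- With equal abscissas the higher point is skipped.
  obtain ⟨R₁, T₁, ⟨t₁, a1, a2⟩, a3, a4, a5⟩ := ih _ (by simp) h₁.tail h₂ rfl
  obtain ⟨R₂, T₂, ⟨t₂, b1, b2⟩, b3, b4, b5⟩ := ih _ (by simp) h₁ h₂.tail rfl
  simp at a1 a4 a5 b1 b4 b5
  rcases lt_trichotomy p.1 q.1 with hpq | hpq | hpq
  · obtain ⟨T, ⟨t, c1, c2⟩, c3⟩ := calls_push p R₁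
    have := length_push p R₁
    refine ⟨push p R₁, T₁ + T + 200, .of_ev (body := Expr.mergeBody) rfl ?_,
      a3.merge_left h₁ h₂ hpq, by simp; omega, by simp; omega⟩
    have e : encodePoint p = .cons (.real p.1) (.real p.2) := rfl
    have e' : encodePoint q = .cons (.real q.1) (.real q.2) := rfl
    simp only [e, e'] at a1 c1
    simp [Expr.mergeBody, e, e', hpq, a1, c1]
    omega
  · have e : encodePoint p = .cons (.real p.1) (.real p.2) := rfl
    have e' : encodePoint q = .cons (.real q.1) (.real q.2) := rfl
    by_cases hlt : p.2 < q.2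
    · refine ⟨R₂, T₂ + 200, .of_ev (body := Expr.mergeBody) rfl ?_,
        b3.merge_skip hpq hlt.le, by simp; omega, by simp; omega⟩
      simp only [e, hpq] at b1
      simp [Expr.mergeBody, e, e', hpq, hlt, b1]
      omega
    · refine ⟨R₁, T₁ + 200, .of_ev (body := Expr.mergeBody) rfl ?_, ?_,
        by simp; omega, by simp; omega⟩
      · simp only [e'] at a1
        simp [Expr.mergeBody, e, e', hpq, hlt, a1]
        omega
      · rw [Set.union_comm] at a3 ⊢
        exact a3.merge_skip hpq.symm (not_lt.1 hlt)
  · obtain ⟨T, ⟨t, c1, c2⟩, c3⟩ := calls_push q R₂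
    have := length_push q R₂
    refine ⟨push q R₂, T₂ + T + 200, .of_ev (body := Expr.mergeBody) rfl ?_, ?_,
      by simp; omega, by simp; omega⟩
    · have e : encodePoint p = .cons (.real p.1) (.real p.2) := rfl
      have e' : encodePoint q = .cons (.real q.1) (.real q.2) := rfl
      simp only [e, e'] at b1 c1
      simp [Expr.mergeBody, e, e', hpq, hpq.not_gt, b1, c1]
      omega
    · rw [Set.union_comm] at b3 ⊢
      exact b3.merge_left h₂ h₁ hpq

theorem calls_join (q : ℝ × ℝ) (m l : List (ℝ × ℝ)) :
    Calls prog 15 (.cons (encodePoint q) (.cons (encodePoints m) (encodePoints l)))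
      (encodePoints (joinAt q m l)) (100 * l.length + 100) := by
  refine .of_ev (body := Expr.joinBody) rfl ?_
  fun_induction joinAt q m l with
  | case1 => simp [Expr.joinBody]
  | case2 =>
    obtain ⟨t, h1, h2⟩ := calls_eq q q
    simp [Expr.joinBody, h1]
    omega
  | case3 p h =>
    obtain ⟨t, h1, h2⟩ := calls_eq p q
    simp [Expr.joinBody, h1, h]
    omega
  | case4 p p' l ih =>
    obtain ⟨t, h1, h2⟩ := Calls.of_ev (f := 15) (body := Expr.joinBody) rfl ih
    simp at h1 h2
    simp [Expr.joinBody, h1]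
    omega

/-! ### Forests -/

/-- A forest is stored as the record of mark and weight of the first root, and of the forests of
its children and its siblings. -/
def encodeForest : Forest (ℝ × ℝ) → Val
  | .nil => .nil
  | .node b w c s =>
    .cons (.cons (.nat b.toNat) (encodePoint w)) (.cons (encodeForest c) (encodeForest s))

@[simp] theorem encodeForest_nil : encodeForest .nil = .nil := rfl

@[simp] theorem encodeForest_node (b : Bool) (w : ℝ × ℝ) (c s : Forest (ℝ × ℝ)) :
    encodeForest (.node b w c s) =
      .cons (.cons (.nat b.toNat) (encodePoint w)) (.cons (encodeForest c) (encodeForest s)) := rfl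

open Forest

theorem calls_size (F : Forest (ℝ × ℝ)) :
    Calls prog 5 (encodeForest F) (.nat F.size) (50 * F.size + 20) := by
  refine .of_ev (body := Expr.sizeBody) rfl ?_
  induction F with
  | nil => simp [Expr.sizeBody, Forest.size]
  | node b w c s hc hs =>
    obtain ⟨t, h1, h2⟩ := Calls.of_ev (f := 5) (body := Expr.sizeBody) rfl hc
    obtain ⟨t', h3, h4⟩ := Calls.of_ev (f := 5) (body := Expr.sizeBody) rfl hs
    simp [Expr.sizeBody, Forest.size, h1, h3]
    omega

theorem calls_revAppend (F G : Forest (ℝ × ℝ)) :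
    Calls prog 6 (.cons (encodeForest F) (encodeForest G)) (encodeForest (revAppend F G))
      (40 * F.size + 40) := by
  refine .of_ev (body := Expr.revBody) rfl ?_
  induction F generalizing G with
  | nil => simp [Expr.revBody, revAppend, Forest.size]
  | node b w c s hc hs =>
    obtain ⟨t, h1, h2⟩ := Calls.of_ev (f := 6) (body := Expr.revBody) rfl (hs (.node b w c G))
    simp at h1
    simp [Expr.revBody, revAppend, Forest.size, h1]
    omega

/-- Branches in `acc` are known to have at most half of the vertices. If a branch has more than
half, the root moves into it, and all the rest becomes one small branch that is never examined
again. So the search is a structural recursion on `F`, each step of which costs O(N). -/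
theorem calls_search (N : ℕ) (w : ℝ × ℝ) (acc F : Forest (ℝ × ℝ))
    (hN : 1 + acc.size + F.size = N) (hacc : acc.TreesLE (N / 2)) : ∃ w' G,
      Calls prog 7 (.cons (.nat N) (.cons (encodePoint w) (.cons (encodeForest acc)
        (encodeForest F)))) (.cons (encodePoint w') (encodeForest G))
        (300 * (F.size + 1) * (N + 1)) ∧
      1 + G.size = N ∧ G.TreesLE (N / 2) ∧ treeSums w' G = treeSums w (revAppend acc F) := by
  induction F generalizing acc w with
  | nil =>
    refine ⟨w, acc, .of_ev (body := Expr.searchBody) rfl ?_, by simpa [Forest.size] using hN, hacc,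
      treeSums_congr fun s => by simp [sums_revAppend, sums]⟩
    simp [Expr.searchBody, Forest.size]
    omega
  | node b v c r hc hr =>
    obtain ⟨t₁, h1, h2⟩ := calls_size c
    simp only [Forest.size] at hN
    by_cases hb : N < c.size + 1 + (c.size + 1)
    · obtain ⟨t₂, h3, h4⟩ := calls_revAppend acc r
      have hs := size_revAppend acc r
      obtain ⟨w', G, ⟨t₃, h5, h6⟩, h7, h8, h9⟩ := hc v (.node (!b) w (revAppend acc r) .nil)
        (by simp only [Forest.size, hs]; omega) ⟨by omega, trivial⟩
      have e : (!b).toNat = 1 - b.toNat := by cases b <;> rfl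
      simp [e] at h5
      refine ⟨w', G, .of_ev (body := Expr.searchBody) rfl ?_, h7, h8, h9.trans ?_⟩
      · simp [Expr.searchBody, h1, hb, h3, h5, Forest.size]
        nlinarith [Nat.zero_le (r.size * N)]
      · rw [treeSums_congr (G := .node (!b) w (revAppend acc r) c), ← treeSums_rotate]
        · refine treeSums_congr fun s => ?_
          simp only [sums_revAppend, sums]
          ac_rfl
        · intro s
          simp [sums_revAppend, sums]
    · obtain ⟨w', G, ⟨t₃, h5, h6⟩, h7, h8, h9⟩ := hr w (.node b v c acc)
        (by simp only [Forest.size]; omega) ⟨by omega, hacc⟩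
      simp at h5
      refine ⟨w', G, .of_ev (body := Expr.searchBody) rfl ?_, h7, h8, h9.trans ?_⟩
      · simp [Expr.searchBody, h1, hb, h5, Forest.size]
        nlinarith [Nat.zero_le (c.size * N)]
      · refine treeSums_congr fun s => ?_
        simp only [sums_revAppend, sums]
        ac_rfl

/-- Sizes are recomputed at every comparison, hence the product in the cost. The mark of the
inserted root is arbitrary, as `freeSums` ignores it. -/
theorem calls_insert (w : ℝ × ℝ) (c L : Forest (ℝ × ℝ)) (hL : L.Descending) : ∃ R,
    Calls prog 8 (.cons (.cons (encodePoint w) (encodeForest c)) (encodeForest L))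
      (encodeForest R) (200 * (L.size + 1) * (c.size + 1)) ∧
    freeSums R = treeSums w c + freeSums L ∧ R.Descending ∧ R.size = 1 + c.size + L.size ∧
    ∀ m, 1 + c.size ≤ m → L.TreesLE m → R.TreesLE m := by
  induction L with
  | nil =>
    refine ⟨.node false w c .nil, .of_ev (body := Expr.insertBody) rfl ?_, rfl, ⟨trivial, trivial⟩,
      rfl, fun m h _ => ⟨h, trivial⟩⟩
    simp [Expr.insertBody, Forest.size]
    omega
  | node b v d r hd hr =>
    obtain ⟨R, ⟨t, h1, h2⟩, h3, h4, h5, h6⟩ := hr hL.2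
    obtain ⟨t₁, h7, h8⟩ := calls_size c
    obtain ⟨t₂, h9, h10⟩ := calls_size d
    by_cases hlt : c.size < d.size
    · refine ⟨.node b v d R, .of_ev (body := Expr.insertBody) rfl ?_, ?_, ⟨?_, h4⟩, ?_, ?_⟩
      · simp [Expr.insertBody, h7, h9, hlt, h1, Forest.size]
        nlinarith [Nat.zero_le (c.size * d.size)]
      · simp only [freeSums, h3]
        ac_rfl
      · exact h6 _ (by omega) hL.1
      · simp only [Forest.size, h5]
        omega
      · exact fun m h h' => ⟨h'.1, h6 m h h'.2⟩
    · refine ⟨.node false w c (.node b v d r), .of_ev (body := Expr.insertBody) rfl ?_, rfl,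
        ⟨⟨by omega, hL.1.mono (by omega)⟩, hL⟩, rfl, fun m h h' => ⟨h, h'⟩⟩
      simp [Expr.insertBody, h7, h9, hlt, Forest.size]
      nlinarith [Nat.zero_le (c.size * d.size), Nat.zero_le (c.size * r.size)]

/-- A root with `b = s` has the state of its parent: its weight goes into the translation, and its
children are treated with the same `s`. Any other root may take both states, so its whole tree is
independent of the rest and is moved to `L`. The bound `M` on the total size survives the recursion
because sizes never grow. -/
theorem calls_strip (s : Bool) (F : Forest (ℝ × ℝ)) (x : ℝ × ℝ) (L : Forest (ℝ × ℝ))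
    (hL : L.Descending) (M : ℕ) (hM : F.size + L.size ≤ M) : ∃ y R,
    Calls prog 9 (.cons (.nat s.toNat) (.cons (encodeForest F) (.cons (encodePoint x)
      (encodeForest L)))) (.cons (encodePoint y) (encodeForest R))
      (400 * (2 * F.size + 1) * (M + 1)) ∧
    {y} + freeSums R = {x} + F.sums s + freeSums L ∧ R.Descending ∧ R.size ≤ F.size + L.size ∧
    ∀ m, F.TreesLE m → L.TreesLE m → R.TreesLE m := by
  induction F generalizing x L with
  | nil =>
    refine ⟨x, L, .of_ev (body := Expr.stripBody) rfl ?_, by simp [sums], hL, by simp,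
      fun m _ h => h⟩
    simp [Expr.stripBody, Forest.size]
    omega
  | node b w c r hc hr =>
    simp only [Forest.size] at hM
    by_cases hb : b = s
    · subst hb
      obtain ⟨y, R, ⟨t, h1, h2⟩, h3, h4, h5, h6⟩ := hc ((if b then w else 0) + x) L hL (by omega)
      obtain ⟨y', R', ⟨t', h1', h2'⟩, h3', h4', h5', h6'⟩ := hr y R h4 (by omega)
      obtain ⟨t₁, h7, h8⟩ := calls_add w x
      refine ⟨y', R', .of_ev (body := Expr.stripBody) rfl ?_, ?_, h4', ?_, ?_⟩
      · simp only [Forest.size]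
        have e : 400 * (2 * (1 + c.size + r.size) + 1) * (M + 1) = 400 * (2 * c.size + 1) * (M + 1) +
          400 * (2 * r.size + 1) * (M + 1) + 400 * (M + 1) := by ring
        rw [e]
        cases b
        · simp at h1 h1'
          simp [Expr.stripBody, h1, h1']
          omega
        · simp at h1 h1'
          simp [Expr.stripBody, h1, h1', h7]
          omega
      · rw [h3', add_assoc, add_comm (r.sums b), ← add_assoc, h3, sums, if_pos rfl, rootSums,
          ← Set.singleton_add_singleton]
        ac_rfl
      · simp only [Forest.size]
        omega
      -- The trees below a removed root are smaller than the tree they came from.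
      · exact fun m h h' => h6' m h.2 (h6 m ((treesLE_size c).mono (by have := h.1; omega)) h')
    · obtain ⟨R, ⟨t, h1, h2⟩, h3, h4, h5, h6⟩ := calls_insert w c L hL
      obtain ⟨y', R', ⟨t', h1', h2'⟩, h3', h4', h5', h6'⟩ := hr x R h4 (by omega)
      refine ⟨y', R', .of_ev (body := Expr.stripBody) rfl ?_, ?_, h4', ?_, ?_⟩
      · simp only [Forest.size]
        have hb' : b.toNat ≠ s.toNat := by cases b <;> cases s <;> simp_all
        simp [Expr.stripBody, h1, h1', hb']
        nlinarith [Nat.mul_le_mul_right (c.size + 1) (show L.size + 1 ≤ M + 1 by omega)]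
      · rw [h3', h3, sums, if_neg hb, treeSums]
        ac_rfl
      · simp only [Forest.size]
        omega
      · exact fun m h h' => h6' m h.2 (h6 m h.1 h')


/-! ### The recursion -/

theorem sums_nonempty (F : Forest (ℝ × ℝ)) (s : Bool) : (F.sums s).Nonempty := by
  induction F generalizing s with
  | nil => exact Set.singleton_nonempty 0
  | node b w c r hc hr =>
    refine Set.Nonempty.add ?_ (hr s)
    split_ifs
    · exact (Set.singleton_nonempty _).add (hc s)
    · exact ((Set.singleton_nonempty _).add (hc true)).inl

theorem treeSums_nonempty (w : ℝ × ℝ) (F : Forest (ℝ × ℝ)) : (treeSums w F).Nonempty :=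
  ((Set.singleton_nonempty _).add (sums_nonempty F true)).inl

theorem freeSums_nonempty (F : Forest (ℝ × ℝ)) : (freeSums F).Nonempty := by
  induction F with
  | nil => exact Set.singleton_nonempty 0
  | node b w c r hc hr => exact (treeSums_nonempty w c).add hr

/-- The first tree, of size a, is the largest. The remaining chain has at most 1 + 2·(sum of
squares) ≤ 1 + 2ar points for remaining size r, so the cost of this Minkowski sum is absorbed by the
growth of `(L.size + 1) ^ 2`. -/
theorem calls_solveForest {m K : ℕ} (L : Forest (ℝ × ℝ)) (x : ℝ × ℝ) (hL : L.Descending)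
    (hm : L.TreesLE m) (ih : ∀ (w : ℝ × ℝ) (c : Forest (ℝ × ℝ)), 1 + c.size ≤ m → ∃ l,
      Calls prog 14 (.cons (encodePoint w) (encodeForest c)) (encodePoints l)
        (K * (1 + c.size) ^ 2) ∧
      IsLowerBoundary l (treeSums w c) ∧ l.length ≤ 2 * (1 + c.size) ^ 2) :
    ∃ l, Calls prog 13 (.cons (encodeForest L) (encodePoint x)) (encodePoints l)
        (K * L.squares + 2400 * (L.size + 1) ^ 2) ∧
      IsLowerBoundary l ({x} + freeSums L) ∧ l.length ≤ 1 + 2 * L.squares := by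
  induction L with
  | nil =>
    refine ⟨[x], .of_ev (body := Expr.solveForestBody) rfl ?_, ?_, by simp⟩
    · simp [Expr.solveForestBody, Forest.size]
    · simpa [freeSums] using isLowerBoundary_singleton x
  | node b w c r hc hr =>
    obtain ⟨l₁, ⟨t₁, h1, h2⟩, h3, h4⟩ := hr hL.2 hm.2
    obtain ⟨l₂, ⟨t₂, h5, h6⟩, h7, h8⟩ := ih w c hm.1
    have n₁ : l₁ ≠ [] := h3.ne_nil ((Set.singleton_nonempty x).add (freeSums_nonempty r))
    have n₂ : l₂ ≠ [] := h7.ne_nil (treeSums_nonempty w c)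
    obtain ⟨l, T, ⟨t, h9, h10⟩, h11, h12, h13⟩ := calls_mink h7.chain h3.chain n₂ n₁
    refine ⟨l, .of_ev (body := Expr.solveForestBody) rfl ?_, ?_, ?_⟩
    · simp [Expr.solveForestBody, h1, h5, h9]
      have hsq := squares_le hL.1
      simp only [squares, Forest.size]
      rw [mul_add]
      nlinarith [Nat.zero_le (c.size * r.size)]
    · have := h7.add h3 h11
      convert this using 1
      simp only [freeSums]
      ac_rfl
    · simp only [squares]
      omega

theorem calls_solveTree (w : ℝ × ℝ) (c : Forest (ℝ × ℝ)) : ∃ l,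
    Calls prog 14 (.cons (encodePoint w) (encodeForest c)) (encodePoints l)
      (20000 * (1 + Nat.log 2 (1 + c.size)) * (1 + c.size) ^ 2) ∧
    IsLowerBoundary l (treeSums w c) ∧ l.length ≤ 2 * (1 + c.size) ^ 2 := by
  induction hn : 1 + c.size using Nat.strong_induction_on generalizing w c with
  | _ n ih =>
  -- Halving the size lowers the logarithm by one, so the factor for the subtrees is `Nat.log 2 n`
  -- instead of `1 + Nat.log 2 n`; the difference pays for the current level.
  have hlog : ∀ k, 1 ≤ k → k ≤ n / 2 → 1 + Nat.log 2 k ≤ Nat.log 2 n := by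
    intro k hk hkn
    rw [Nat.log_of_one_lt_of_le (b := 2) (n := n) (by omega) (by omega), add_comm]
    exact Nat.add_le_add_right (Nat.log_mono_right hkn) 1
  have ih' : ∀ (v : ℝ × ℝ) (d : Forest (ℝ × ℝ)), 1 + d.size ≤ n / 2 → ∃ l,
      Calls prog 14 (.cons (encodePoint v) (encodeForest d)) (encodePoints l)
        (20000 * Nat.log 2 n * (1 + d.size) ^ 2) ∧
      IsLowerBoundary l (treeSums v d) ∧ l.length ≤ 2 * (1 + d.size) ^ 2 := by
    intro v d hd
    obtain ⟨l, h1, h2, h3⟩ := ih (1 + d.size) (by omega) v d rfl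
    exact ⟨l, h1.mono (Nat.mul_le_mul_right _ (Nat.mul_le_mul_left _ (hlog _ (by omega) hd))),
      h2, h3⟩
  obtain ⟨t₀, a1, a2⟩ := calls_size c
  obtain ⟨v, F, ⟨t₁, b1, b2⟩, b3, b4, b5⟩ := calls_search n w .nil c (by simpa [Forest.size] using hn)
    trivial
  obtain ⟨x, A, ⟨t₂, c1, c2⟩, c3, c4, c5, c6⟩ := calls_strip true F v .nil trivial F.size
    (by simp [Forest.size])
  obtain ⟨y, B, ⟨t₃, d1, d2⟩, d3, d4, d5, d6⟩ := calls_strip false F 0 .nil trivial F.size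
    (by simp [Forest.size])
  obtain ⟨l₁, ⟨t₄, e1, e2⟩, e3, e4⟩ := calls_solveForest A x c4 (c6 _ b4 trivial) ih'
  obtain ⟨l₂, ⟨t₅, f1, f2⟩, f3, f4⟩ := calls_solveForest B y d4 (d6 _ b4 trivial) ih'
  obtain ⟨l, T, ⟨t₆, g1, g2⟩, g3, g4, g5⟩ := calls_merge e3.chain f3.chain
  have hA := squares_le (c6 _ b4 trivial)
  have hB := squares_le (d6 _ b4 trivial)
  simp only [Forest.size, add_zero] at c5 d5
  -- The centroid itself is not counted: tree sizes are at most `n / 2` and total at most `n - 1`.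
  have hA2 : 2 * A.squares ≤ n * (n - 1) := by
    calc 2 * A.squares ≤ 2 * (n / 2) * A.size := by rw [mul_assoc]; omega
      _ ≤ n * (n - 1) := Nat.mul_le_mul (by omega) (by omega)
  have hB2 : 2 * B.squares ≤ n * (n - 1) := by
    calc 2 * B.squares ≤ 2 * (n / 2) * B.size := by rw [mul_assoc]; omega
      _ ≤ n * (n - 1) := Nat.mul_le_mul (by omega) (by omega)
  obtain ⟨k, rfl⟩ : ∃ k, n = k + 1 := ⟨n - 1, by omega⟩
  rw [Nat.add_sub_cancel] at hA2 hB2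
  refine ⟨l, .of_ev (body := Expr.solveTreeBody) rfl ?_, ?_, ?_⟩
  · have e : (Val.real 0).cons (.real 0) = encodePoint 0 := rfl
    have e' : c.size + 1 = k + 1 := by omega
    simp at b1 c1 d1
    simp [Expr.solveTreeBody, a1, e, e', b1, c1, d1, e1, f1, g1]
    obtain rfl : c.size = k := by omega
    have hF : F.size = c.size := by omega
    rw [hF] at c2 d2 c5 d5
    have hA3 := Nat.pow_le_pow_left (Nat.add_le_add_right c5 1) 2
    have hB3 := Nat.pow_le_pow_left (Nat.add_le_add_right d5 1) 2
    -- Halved sizes compensate for the two states: the squares over both states together do not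
    -- exceed the square of the whole.
    have hAB : Nat.log 2 (c.size + 1) * (A.squares + B.squares) ≤
        Nat.log 2 (c.size + 1) * (c.size + 1) ^ 2 :=
      Nat.mul_le_mul_left _ (by nlinarith)
    nlinarith
  · have := e3.union f3 g3
    convert this using 1
    rw [c3, d3]
    have : treeSums w c = treeSums w (revAppend .nil c) := rfl
    rw [this, ← b5]
    simp [treeSums, rootSums, freeSums]
  · nlinarith

/-! ### Reading the input -/

theorem calls_lookup (W : List (ℝ × ℝ)) (i : ℕ) (hi : i < W.length) :
    Calls prog 2 (.cons (.nat i) (encodePoints W)) (encodePoint W[i]) (20 * i + 20) := by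
  refine .of_ev (body := Expr.lookupBody) rfl ?_
  induction W generalizing i with
  | nil => simp at hi
  | cons p W ih =>
    cases i with
    | zero => simp [Expr.lookupBody]
    | succ i =>
      obtain ⟨t, h1, h2⟩ := Calls.of_ev (f := 2) (body := Expr.lookupBody) rfl
        (ih i (by simpa using hi))
      simp [Expr.lookupBody, h1]
      omega

/-- A list of directed edges. -/
def encodeEdges {n : ℕ} (E : List (Fin n × Fin n)) : Val := encodeList (E.map encodeEdge)

@[simp] theorem encodeEdges_nil {n : ℕ} : encodeEdges ([] : List (Fin n × Fin n)) = .nil := rfl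

@[simp] theorem encodeEdges_cons {n : ℕ} (a : Fin n × Fin n) (E : List (Fin n × Fin n)) :
    encodeEdges (a :: E) = .cons (.cons (.nat a.1) (.nat a.2)) (encodeEdges E) := rfl

theorem calls_find {n : ℕ} (v : Fin n) (E : List (Fin n × Fin n)) :
    (Calls prog 1 (.cons (.nat v) (encodeEdges E)) .nil (60 * E.length + 60) ∧
      ∀ a ∈ E, a.1 ≠ v ∧ a.2 ≠ v) ∨
    ∃ b u E', Calls prog 1 (.cons (.nat v) (encodeEdges E))
      (.cons (.cons (.nat (Bool.toNat b)) (.nat (u : Fin n))) (encodeEdges E'))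
      (60 * E.length + 60) ∧ E.Perm (Forest.edge b v u :: E') := by
  induction E with
  | nil =>
    refine .inl ⟨.of_ev (body := Expr.findBody) rfl ?_, by simp⟩
    simp [Expr.findBody]
  | cons a E ih =>
    by_cases h1 : v = a.1
    · refine .inr ⟨false, a.2, E, .of_ev (body := Expr.findBody) rfl ?_, ?_⟩
      · simp [Expr.findBody, h1]
      · rw [h1]
        rfl
    by_cases h2 : v = a.2
    · refine .inr ⟨true, a.1, E, .of_ev (body := Expr.findBody) rfl ?_, ?_⟩
      · simp [Expr.findBody, h2, Fin.val_inj.not.2 (h2 ▸ h1)]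
      · rw [h2]
        rfl
    rw [← Fin.val_inj] at h1 h2
    rcases ih with ⟨⟨t, h3, h4⟩, h5⟩ | ⟨b, u, E', ⟨t, h3, h4⟩, h5⟩
    · refine .inl ⟨.of_ev (body := Expr.findBody) rfl ?_, ?_⟩
      · simp [Expr.findBody, h1, h2, h3]
        omega
      · rw [Fin.val_inj] at h1 h2
        simp only [List.mem_cons, forall_eq_or_imp]
        exact ⟨⟨Ne.symm h1, Ne.symm h2⟩, h5⟩
    · refine .inr ⟨b, u, a :: E', .of_ev (body := Expr.findBody) rfl ?_, ?_⟩
      · simp [Expr.findBody, h1, h2, h3]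
        omega
      · exact (h5.cons a).trans (.swap _ _ _)

/-- A depth-first traversal that deletes each edge when it is used, so no visited marks are needed.
When it returns, no remaining edge meets a visited vertex. For an arbitrary edge list vertices could
repeat; for polytrees `IsPolytree.spanning` excludes this. -/
theorem calls_build {n : ℕ} (w : Fin n → ℝ × ℝ) (v : Fin n) (E : List (Fin n × Fin n)) (M : ℕ)
    (hM : E.length + n ≤ M) : ∃ (F : Forest (Fin n)) (E' : List (Fin n × Fin n)),
    Calls prog 3 (.cons (.nat v) (.cons (encodeEdges E) (encodePoints (List.ofFn w))))
      (.cons (encodeForest (F.map w)) (encodeEdges E')) (300 * (2 * F.size + 1) * (M + 1)) ∧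
    (F.edges v ++ E').Perm E ∧ ∀ x ∈ v :: F.verts, ∀ a ∈ E', a.1 ≠ x ∧ a.2 ≠ x := by
  induction hn : E.length using Nat.strong_induction_on generalizing v E with
  | _ k ih =>
  subst hn
  rcases calls_find v E with ⟨⟨t, h1, h2⟩, h3⟩ | ⟨b, u, E₁, ⟨t, h1, h2⟩, h3⟩
  · refine ⟨.nil, E, .of_ev (body := Expr.buildBody) rfl ?_, by simp [Forest.edges], ?_⟩
    · simp [Expr.buildBody, h1, Forest.size, Forest.map]
      omega
    · simpa [Forest.verts] using h3
  · have hl := h3.length_eq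
    simp only [List.length_cons] at hl
    obtain ⟨c, E₂, ⟨t₁, h4, h5⟩, h6, h7⟩ := ih E₁.length (by omega) u E₁ (by omega) rfl
    have hl' := h6.length_eq
    simp only [List.length_append] at hl'
    obtain ⟨s, E₃, ⟨t₂, h8, h9⟩, h10, h11⟩ := ih E₂.length (by omega) v E₂ (by omega) rfl
    obtain ⟨t₃, h12, h13⟩ := calls_lookup (List.ofFn w) u (by simp)
    simp only [List.getElem_ofFn, Fin.eta] at h12
    refine ⟨.node b u c s, E₃, .of_ev (body := Expr.buildBody) rfl ?_, ?_, ?_⟩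
    · have := u.isLt
      have e : 300 * (2 * (1 + c.size + s.size) + 1) * (M + 1) = 300 * (2 * c.size + 1) * (M + 1) +
          300 * (2 * s.size + 1) * (M + 1) + 300 * (M + 1) := by ring
      simp [Expr.buildBody, h1, h4, h8, h12, Forest.size, Forest.map]
      rw [e]
      omega
    · refine .trans ?_ h3.symm
      simp only [Forest.edges, List.cons_append, List.append_assoc]
      exact ((List.Perm.append_left _ h10).trans h6).cons _
    · intro x hx a ha
      have ha₂ : a ∈ E₂ := h10.subset (List.mem_append_right _ ha)
      simp only [Forest.verts, List.mem_cons, List.mem_append] at hx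
      rcases hx with rfl | rfl | hx | hx
      · exact h11 x (by simp) a ha
      · exact h7 x (by simp) a ha₂
      · exact h7 x (by simp [hx]) a ha₂
      · exact h11 x (by simp [hx]) a ha

/-! ### Polytrees -/

/-- Without opposite edges, forgetting directions is injective, and a tree has one edge less than
vertices. -/
theorem IsPolytree.length_edges_lt {V : Type*} [Fintype V] {D : Digraph V} (hD : IsPolytree D)
    {n : ℕ} {e : Fin n ≃ V} {E : List (Fin n × Fin n)} (hE : IsEdgeList D e E) :
    E.length + 1 ≤ Fintype.card V := by
  classical
  rw [← hD.isTree.card_edgeFinset]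
  refine Nat.add_le_add_right ?_ 1
  have hn : (E.map fun a => s(e a.1, e a.2)).Nodup := by
    refine hE.1.map_on ?_
    rintro ⟨i, j⟩ h1 ⟨k, l⟩ h2 h
    simp only [Sym2.eq_iff, e.injective.eq_iff] at h
    rcases h with ⟨rfl, rfl⟩ | ⟨rfl, rfl⟩
    · rfl
    · exact absurd ((hE.2 _ _).1 h2) (hD.asymm _ _ ((hE.2 _ _).1 h1))
  rw [← List.length_map (as := E) (fun a => s(e a.1, e a.2)), ← List.toFinset_card_of_nodup hn]
  refine Finset.card_le_card fun x hx => ?_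
  simp only [List.mem_toFinset, List.mem_map] at hx
  obtain ⟨⟨i, j⟩, hij, rfl⟩ := hx
  have hadj := (hE.2 _ _).1 hij
  rw [SimpleGraph.mem_edgeFinset, SimpleGraph.mem_edgeSet, Digraph.toSimpleGraphInclusive,
    SimpleGraph.fromRel_adj]
  refine ⟨fun h => ?_, Or.inl hadj⟩
  simp only at h hadj
  rw [h] at hadj
  exact hD.asymm _ _ hadj hadj

/-- A rooted forest that uses up all edges at its vertices spans the polytree. -/
theorem IsPolytree.spanning {V : Type*} [Fintype V] {D : Digraph V} (hD : IsPolytree D)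
    {n : ℕ} (hn : n = Fintype.card V) {e : Fin n ≃ V} {E E' : List (Fin n × Fin n)}
    (hE : IsEdgeList D e E) {r : Fin n} {F : Forest (Fin n)} (hp : (F.edges r ++ E').Perm E)
    (hE' : ∀ x ∈ r :: F.verts, ∀ a ∈ E', a.1 ≠ x ∧ a.2 ≠ x) :
    (r :: F.verts).Nodup ∧ (∀ i, i ∈ r :: F.verts) ∧
      ∀ i j, (i, j) ∈ F.edges r ↔ D.Adj (e i) (e j) := by
  have hmem : ∀ i, i ∈ r :: F.verts := by
    -- Along an undirected walk from the root, each edge at a visited vertex cannot be left over, so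
    -- it belongs to the forest and its other end is visited.
    intro i
    have hr := hD.isTree.connected.preconnected (e r) (e i)
    rw [SimpleGraph.reachable_iff_reflTransGen] at hr
    suffices ∀ v, Relation.ReflTransGen D.toSimpleGraphInclusive.Adj (e r) v →
        e.symm v ∈ r :: F.verts by simpa using this _ hr
    intro v hv
    induction hv with
    | refl => simp
    | @tail u v _ huv ih =>
      rw [Digraph.toSimpleGraphInclusive, SimpleGraph.fromRel_adj] at huv
      rcases huv.2 with h | h
      · have h1 := hp.symm.subset ((hE.2 (e.symm u) (e.symm v)).2 (by simpa using h))
        rcases List.mem_append.1 h1 with h1 | h1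
        · exact (Forest.mem_of_mem_edges h1).2
        · exact absurd rfl (hE' _ ih _ h1).1
      · have h1 := hp.symm.subset ((hE.2 (e.symm v) (e.symm u)).2 (by simpa using h))
        rcases List.mem_append.1 h1 with h1 | h1
        · exact (Forest.mem_of_mem_edges h1).1
        · exact absurd rfl (hE' _ ih _ h1).2
  refine ⟨?_, hmem, fun i j => ?_⟩
  -- Counting: all `n` vertices occur, but the list has at most `n` entries since it is one longer
  -- than the list of forest edges.
  · have h1 := hD.length_edges_lt hE
    have h2 := hp.length_eq
    rw [List.length_append, Forest.length_edges] at h2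
    have h3 : (r :: F.verts).dedup.length = n := by
      have h : (r :: F.verts).toFinset = Finset.univ := by
        ext i
        simpa using hmem i
      rw [← List.card_toFinset, h, Finset.card_univ, Fintype.card_fin]
    rw [← List.dedup_eq_self]
    refine (List.dedup_sublist _).eq_of_length_le ?_
    rw [h3, List.length_cons, Forest.length_verts]
    omega
  · rw [← hE.2, ← hp.mem_iff, List.mem_append]
    exact ⟨Or.inl, fun h => h.resolve_right fun h => (hE' i (hmem i) _ h).1 rfl⟩

/-! ### Lower and upper boundary of the polygon, and the whole program -/

theorem project_neg {V : Type*} [Fintype V] (w : V → ℝ × ℝ) (F : Set (Set V)) :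
    project (-w) F = -project w F := by
  ext x
  simp only [project, Set.mem_image, Set.mem_neg]
  refine exists_congr fun S => and_congr_right fun _ => ?_
  rw [Set.indicator_neg', ← neg_eq_iff_eq_neg, ← Finset.sum_neg_distrib]
  rfl

theorem project_lowerSets_nonempty {V : Type*} [Fintype V] [PartialOrder V] (w : V → ℝ × ℝ) :
    (project w (lowerSets V)).Nonempty :=
  Set.Nonempty.image _ ⟨Set.univ, isLowerSet_univ⟩

theorem exists_lowerBoundary {V : Type*} [Fintype V] [PartialOrder V] {D : Digraph V}
    (hD : IsPolytree D) (hR : IsReachabilityOrder D) {n : ℕ} (hn : n = Fintype.card V)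
    (w : V → ℝ × ℝ) (e : Fin n ≃ V) {E : List (Fin n × Fin n)} (hE : IsEdgeList D e E)
    (r : Fin n) : ∃ A E' l,
    Calls prog 3 (.cons (.nat r) (.cons (encodeEdges E) (encodePoints (List.ofFn fun i => w (e i)))))
      (.cons A E') (1800 * n ^ 2) ∧
    Calls prog 14 (.cons (encodePoint (w (e r))) A) (encodePoints l)
      (20000 * (1 + Nat.log 2 n) * n ^ 2) ∧
    IsLowerBoundary l (project w (lowerSets V)) ∧ l.length ≤ 2 * n ^ 2 := by
  obtain ⟨F, E', h1, h2, h3⟩ := calls_build (fun i => w (e i)) r E _ le_rfl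
  obtain ⟨h4, h5, h6⟩ := hD.spanning hn hE h2 h3
  obtain ⟨l, h7, h8, h9⟩ := calls_solveTree (w (e r)) (F.map fun i => w (e i))
  rw [treeSums_eq_project hR e w h4 h5 h6] at h8
  have hlen := hD.length_edges_lt hE
  have hs : 1 + F.size = n := by
    have h : (r :: F.verts).toFinset = Finset.univ := by
      ext i
      simpa using h5 i
    have := congrArg Finset.card h
    rw [List.toFinset_card_of_nodup h4, Finset.card_univ, Fintype.card_fin, List.length_cons,
      Forest.length_verts] at this
    omega
  rw [Forest.size_map, hs] at h7 h9
  refine ⟨_, _, l, h1.mono ?_, h7, h8, h9⟩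
  have h10 : 2 * F.size + 1 ≤ 2 * n := by omega
  have h11 : E.length + n + 1 ≤ 2 * n := by omega
  calc 300 * (2 * F.size + 1) * (E.length + n + 1) ≤ 300 * (2 * n) * (2 * n) := by gcongr
    _ ≤ 1800 * n ^ 2 := by nlinarith

theorem prog_correct {V : Type*} [Fintype V] [PartialOrder V] {D : Digraph V}
    (hD : IsPolytree D) (hR : IsReachabilityOrder D) (w : V → ℝ × ℝ)
    (e : Fin (Fintype.card V) ≃ V) {E : List (Fin (Fintype.card V) × Fin (Fintype.card V))}
    (hE : IsEdgeList D e E) : ∃ l t,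
    prog.Computes (encodeInput E fun i => w (e i)) (encodePoints l) t ∧
    IsVertexList l (polygon w) ∧ l.length ≤ 4 * Fintype.card V ^ 2 ∧
    t ≤ 50000 * Fintype.card V ^ 2 * (1 + Nat.log 2 (Fintype.card V)) := by
  generalize hn : Fintype.card V = n at e E
  have hpos : 0 < n := by
    have := hD.length_edges_lt hE
    omega
  obtain ⟨A, E₁, l, ⟨t₁, a1, a2⟩, ⟨t₂, b1, b2⟩, b3, b4⟩ :=
    exists_lowerBoundary hD hR hn.symm w e hE ⟨0, hpos⟩
  obtain ⟨A', E₂, u, ⟨t₃, c1, c2⟩, ⟨t₄, d1, d2⟩, d3, d4⟩ :=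
    exists_lowerBoundary hD hR hn.symm (-w) e hE ⟨0, hpos⟩
  rw [project_neg] at d3
  have hA := project_lowerSets_nonempty w
  obtain ⟨t₅, f1, f2⟩ := calls_neg (List.ofFn fun i => w (e i))
  obtain ⟨t₆, g1, g2⟩ := calls_neg u
  refine ⟨closeBoundary l (u.map Neg.neg), ?_⟩
  have hlen := length_closeBoundary l (u.map Neg.neg)
  have hv := isVertexList_closeBoundary hA b3 d3
  have hm : (List.ofFn fun i => w (e i)).map Neg.neg = List.ofFn fun i => (-w) (e i) := by
    rw [List.map_ofFn]
    rfl
  obtain ⟨k, rfl⟩ : ∃ k, n = k + 1 := ⟨n - 1, by omega⟩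
  obtain ⟨h, l, rfl⟩ := List.exists_cons_of_ne_nil (b3.ne_nil hA)
  obtain ⟨t₇, i1, i2⟩ := calls_join h [] (u.map Neg.neg)
  simp only [List.length_map, List.length_ofFn, List.length_cons] at *
  have hin : encodeInput E (fun i => w (e i)) = .cons (.nat (k + 1)) (.cons (encodeEdges E)
      (encodePoints (List.ofFn fun i => w (e i)))) := rfl
  have hlog : 1 * (k + 1) ^ 2 ≤ (1 + Nat.log 2 (k + 1)) * (k + 1) ^ 2 :=
    Nat.mul_le_mul_right _ (by omega)
  have hsq : k + 1 ≤ (k + 1) ^ 2 := Nat.le_self_pow (by omega) _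
  rw [mul_assoc] at b2 d2
  rw [mul_assoc, mul_comm (_ ^ 2)]
  have key : ∃ t, ev prog [encodeInput E fun i => w (e i)] Expr.mainBody =
      some (encodePoints (closeBoundary (h :: l) (u.map Neg.neg)), t) ∧
      t + 2 ≤ 50000 * ((1 + Nat.log 2 (k + 1)) * (k + 1) ^ 2) := by
    -- With the nonlinear terms replaced by letters the final time estimates are linear.
    generalize (1 + Nat.log 2 (k + 1)) * (k + 1) ^ 2 = X at *
    generalize (k + 1) ^ 2 = Y at *
    rw [hm] at f1
    simp only [List.ofFn_succ, encodePoints_cons] at a1 c1 f1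
    have z : (⟨0, hpos⟩ : Fin (k + 1)) = 0 := rfl
    rw [z] at b1 d1
    simp at a1 b1 c1 d1 f1 g1 i1
    cases hj : joinAt h [] (u.map Neg.neg) with
    | nil =>
      simp only [closeBoundary, hj]
      simp [hj] at i1
      simp [hin, Expr.mainBody, List.ofFn_succ, f1, a1, b1, c1, d1, g1, i1]
      omega
    | cons p m =>
      obtain ⟨t₈, j1, j2⟩ := calls_join p (p :: m) (h :: l)
      simp only [closeBoundary, hj]
      simp only [List.length_cons] at j2
      simp [hj] at i1
      simp at j1
      simp [hin, Expr.mainBody, List.ofFn_succ, f1, a1, b1, c1, d1, g1, i1, j1]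
      omega
  obtain ⟨t, h1, h2⟩ := key
  -- Two more steps: the initial call and the evaluation of its argument.
  refine ⟨t + 2, ?_, hv, by omega, h2⟩
  have := Eval.call (env := [encodeInput E fun i => w (e i)]) (e := .var 0) (f := 0) (.var rfl) rfl
    (ev_sound h1)
  rwa [show 1 + t + 1 = t + 2 by omega] at this

end ParametricClosure

/-! ### Real-valued bounds and the main theorem -/

namespace ParametricClosure

theorem exists_isEdgeList {V : Type*} (D : Digraph V) {n : ℕ} (e : Fin n ≃ V) :
    ∃ E, IsEdgeList D e E := by
  classical
  refine ⟨(Finset.univ.filter fun a : Fin n × Fin n => D.Adj (e a.1) (e a.2)).toList,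
    Finset.nodup_toList _, fun i j => ?_⟩
  simp

theorem IsVertexList.finite_and_ncard {l : List (ℝ × ℝ)} {K : Set (ℝ × ℝ)}
    (h : IsVertexList l K) : (vertices K).Finite ∧ (vertices K).ncard = l.length := by
  classical
  have e : vertices K = (l.toFinset : Set (ℝ × ℝ)) := by
    ext p
    simp [h.mem_iff]
  rw [e]
  exact ⟨Finset.finite_toSet _, by rw [Set.ncard_coe_finset, List.toFinset_card_of_nodup h.nodup]⟩

/-- The combinatorial bound is read off from the output of the program, for an arbitrary numbering
and edge list. -/
theorem IsPolytree.card_vertices_le {V : Type*} [Fintype V] [PartialOrder V] {D : Digraph V}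
    (hD : IsPolytree D) (hR : IsReachabilityOrder D) (w : V → ℝ × ℝ) :
    (vertices (polygon w)).Finite ∧
      ((vertices (polygon w)).ncard : ℝ) ≤ 4 * (Fintype.card V : ℝ) ^ 2 := by
  obtain ⟨E, hE⟩ := exists_isEdgeList D (Fintype.equivFin V).symm
  obtain ⟨l, t, -, h1, h2, -⟩ := prog_correct hD hR w _ hE
  obtain ⟨h3, h4⟩ := h1.finite_and_ncard
  refine ⟨h3, ?_⟩
  rw [h4]
  exact_mod_cast h2

/-- For n ≥ 1 both 1 and log₂ n are at most log₂(n+1). -/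
theorem one_add_natLog_le {n : ℕ} (hn : 1 ≤ n) :
    1 + (Nat.log 2 n : ℝ) ≤ 2 / Real.log 2 * Real.log (n + 1) := by
  have h1 := Real.natLog_le_logb n 2
  have h2 : 0 < Real.log 2 := Real.log_pos one_lt_two
  have h0 : (1 : ℝ) ≤ n := by exact_mod_cast hn
  have h3 : Real.log n ≤ Real.log (n + 1) := Real.log_le_log (by linarith) (by linarith)
  have h4 : Real.log 2 ≤ Real.log (n + 1) := Real.log_le_log two_pos (by linarith)
  rw [Real.logb, Nat.cast_ofNat, le_div_iff₀ h2] at h1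
  rw [div_mul_eq_mul_div, le_div_iff₀ h2]
  linarith

theorem IsPolytree.constructsPolygon {V : Type*} [Fintype V] [PartialOrder V] {D : Digraph V}
    (hD : IsPolytree D) (hR : IsReachabilityOrder D) {T : ℝ}
    (hT : 100000 / Real.log 2 * (Fintype.card V : ℝ) ^ 2 * Real.log (Fintype.card V + 1) ≤ T) :
    prog.ConstructsPolygon D T := by
  intro w e E hE
  obtain ⟨l, t, h1, h2, -, h3⟩ := prog_correct hD hR w e hE
  refine ⟨l, t, h1, h2, le_trans ?_ hT⟩
  have hn : 1 ≤ Fintype.card V := by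
    have := hD.length_edges_lt hE
    omega
  calc (t : ℝ) ≤ 50000 * (Fintype.card V : ℝ) ^ 2 * (1 + Nat.log 2 (Fintype.card V)) := by
        exact_mod_cast h3
    _ ≤ 50000 * (Fintype.card V : ℝ) ^ 2 *
        (2 / Real.log 2 * Real.log (Fintype.card V + 1)) := by
        gcongr
        exact one_add_natLog_le hn
    _ = 100000 / Real.log 2 * (Fintype.card V : ℝ) ^ 2 * Real.log (Fintype.card V + 1) := by
        ring

theorem sq_le_rpow {n : ℕ} (hn : 1 ≤ n) :
    (n : ℝ) ^ 2 ≤ (n : ℝ) ^ (1 + 1 / Real.logb 2 (3 / 2)) := by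
  have h1 : 0 < Real.logb 2 (3 / 2) := Real.logb_pos one_lt_two (by norm_num)
  have h2 : Real.logb 2 (3 / 2) ≤ 1 := by
    rw [Real.logb_le_iff_le_rpow one_lt_two (by norm_num)]
    norm_num
  have h3 : 1 ≤ 1 / Real.logb 2 (3 / 2) := (one_le_div h1).2 h2
  rw [← Real.rpow_natCast]
  refine Real.rpow_le_rpow_of_exponent_le (by exact_mod_cast hn) ?_
  push_cast
  linarith

theorem IsPolytree.card_pos {V : Type*} [Fintype V] {D : Digraph V} (hD : IsPolytree D) :
    1 ≤ Fintype.card V :=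
  have := hD.isTree.connected.nonempty
  Fintype.card_pos

end ParametricClosure

theorem mainTheorem5 :
    (∃ C : ℝ, ∀ (V : Type*) [Fintype V] [PartialOrder V] (D : Digraph V),
      ParametricClosure.IsPolytree D → ParametricClosure.IsReachabilityOrder D →
      ∀ w : V → ℝ × ℝ,
        (ParametricClosure.vertices (ParametricClosure.polygon w)).Finite ∧
        ((ParametricClosure.vertices (ParametricClosure.polygon w)).ncard : ℝ) ≤
          C * (Fintype.card V : ℝ) ^ (1 + 1 / Real.logb 2 (3 / 2))) ∧
    (∃ (P : ParametricClosure.Program) (C : ℝ),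
      ∀ (V : Type*) [Fintype V] [PartialOrder V] (D : Digraph V),
      ParametricClosure.IsPolytree D → ParametricClosure.IsReachabilityOrder D →
        P.ConstructsPolygon D
          (C * (Fintype.card V : ℝ) ^ (1 + 1 / Real.logb 2 (3 / 2)) *
            Real.log (Fintype.card V + 1))) ∧
    (∃ C : ℝ, ∀ (V : Type*) [Fintype V] [PartialOrder V] (D : Digraph V),
      ParametricClosure.IsOrientedPath D → ParametricClosure.IsReachabilityOrder D →
      ∀ w : V → ℝ × ℝ,
        (ParametricClosure.vertices (ParametricClosure.polygon w)).Finite ∧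
        ((ParametricClosure.vertices (ParametricClosure.polygon w)).ncard : ℝ) ≤
          C * (Fintype.card V : ℝ) ^ 2) ∧
    (∃ (P : ParametricClosure.Program) (C : ℝ),
      ∀ (V : Type*) [Fintype V] [PartialOrder V] (D : Digraph V),
      ParametricClosure.IsOrientedPath D → ParametricClosure.IsReachabilityOrder D →
        P.ConstructsPolygon D
          (C * (Fintype.card V : ℝ) ^ 2 * Real.log (Fintype.card V + 1))) := by
  refine ⟨⟨4, fun V _ _ D hD hR w => ?_⟩,
    ⟨ParametricClosure.prog, 100000 / Real.log 2, fun V _ _ D hD hR => ?_⟩,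
    ⟨4, fun V _ _ D hD hR w => hD.isPolytree.card_vertices_le hR w⟩,
    ⟨ParametricClosure.prog, 100000 / Real.log 2,
      fun V _ _ D hD hR => hD.isPolytree.constructsPolygon hR le_rfl⟩⟩
  · obtain ⟨h1, h2⟩ := hD.card_vertices_le hR w
    exact ⟨h1, h2.trans (mul_le_mul_of_nonneg_left (ParametricClosure.sq_le_rpow hD.card_pos)
      (by norm_num))⟩
  · have h := ParametricClosure.sq_le_rpow hD.card_pos
    have h1 : 0 ≤ Real.log ((Fintype.card V : ℝ) + 1) :=
      Real.log_nonneg (le_add_of_nonneg_left (Nat.cast_nonneg _))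
    have h2 : 0 ≤ Real.log 2 := Real.log_nonneg one_le_two
    exact hD.constructsPolygon hR (by gcongr)
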